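/- Notation. Let $0<q<1$. For $t\in\mathbb C$, $m\in\mathbb N_0$ put $(t;q)_m=\prod_{i=0}^{m-1}(1-tq^i)$, $(t;q)_\infty=\prod_{i\ge 0}(1-tq^i)$, and $(t_1,\dots,t_r;q)_m=(t_1;q)_m\cdots(t_r;q)_m$ for $m\in\mathbb N_0\cup\{\infty\}$; a superscript $\pm$, as in $tz^{\pm}$, means that both $tz$ and $tz^{-1}$ occur in the list. Let $${}_4\phi_3\!\left({a_1,a_2,a_3,a_4\atop b_1,b_2,b_3};q,y\right)=\sum_{j\ge0}\frac{(a_1,a_2,a_3,a_4;q)_j}{(q,b_1,b_2,b_3;q)_j}\,y^j ,$$ where a series with $a_1=q^{-m}$, $m\in\mathbb N_0$, is understood to stop at $j=m$. For $x=\frac12(z+z^{-1})$ the Askey--Wilson polynomials are $$p_n(x;a,b,c,d|q)=a^{-n}(ab,ac,ad;q)_n\;{}_4\phi_3\!\left({q^{-n},q^{n-1}abcd,az,az^{-1}\atop ab,ac,ad};q,q\right)$$ (with the denominators $(ab,ac,ad;q)_j$, $0\le j\le n$, cancelled against the prefactor $(ab,ac,ad;q)_n$, so that $p_n$ is defined for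 all $b,c,d$), and $$w(x;a,b,c,d|q)=\frac{(z^{\pm2};q)_\infty}{(az^{\pm},bz^{\pm},cz^{\pm},dz^{\pm};q)_\infty}.$$ **Corollary.** Let $n,k\in\mathbb N_0$, $0<q<1$, and let $a,b,c,d,e,f\in\mathbb C\setminus\{0\}$ with $|a|,|b|,|c|,|f|<1$. Then the integral $$\mathcal I_{n,k}(a,b,c,d,e,f|q):=\int_{-1}^1 p_n(x;a,b,c,d|q)\,p_k(x;a,b,e,f|q)\,w(x;a,b,c,f|q)\,\frac{dx}{\sqrt{1-x^2}}$$ converges absolutely, and the following hold. (i) If $(cd;q)_n\neq0$, $(\frac ec;q)_k\ne0$ and $(q^{1-k}\frac ce;q)_n\neq0$, then $${}_4\phi_3\!\left({q^{-n},q^{n-1}abcd,cf,\frac{qc}{e}\atop cd,q^kabcf,q^{1-k}\frac ce};q,q\right)=c^{n-k}\,\frac{(q,cf,q^nac,q^nbc,q^kab,q^kaf,q^kbf;q)_\infty}{2\pi\,(cd;q)_n(\frac ec;q)_k(q^kabcf;q)_\infty}\;\mathcal I_{n,k}(a,b,c,d,e,f|q).$$ (ii) If $(ef;q)_k\neq0$,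 $(\frac df;q)_n\ne0$ and $(q^{1-n}\frac fd;q)_k\neq0$, then $${}_4\phi_3\!\left({q^{-k},q^{k-1}abef,cf,\frac{qf}{d}\atop ef,q^nabcf,q^{1-n}\frac fd};q,q\right)=f^{k-n}\,\frac{(q,cf,q^nab,q^nac,q^nbc,q^kaf,q^kbf;q)_\infty}{2\pi\,(\frac df;q)_n(ef;q)_k(q^nabcf;q)_\infty}\;\mathcal I_{n,k}(a,b,c,d,e,f|q).$$ -/

import Mathlib

open Filter Topology

noncomputable section

/-- The finite `q`-shifted factorial `(a; q)_n = (1 - a)(1 - a q) ⋯ (1 - a q ^ (n - 1))`. -/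
def qPoch (a q : ℂ) (n : ℕ) : ℂ := ∏ i ∈ Finset.range n, (1 - a * q ^ i)

/-- The infinite `q`-shifted factorial `(a; q)_∞`, for `|q| < 1`. -/
def qPochInf (a q : ℂ) : ℂ := ∏' i : ℕ, (1 - a * q ^ i)

/-- For `|q| < 1`, `(a; q)_∞` is the limit of `(a; q)_n`. -/
theorem qPochInf_tendsto (a q : ℂ) (hq : ‖q‖ < 1) :
    Tendsto (fun n => qPoch a q n) atTop (𝓝 (qPochInf a q)) := by
  have hs : Summable (fun i : ℕ => ‖-(a * q ^ i)‖) := by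
    simp only [norm_neg, norm_mul, norm_pow]
    exact (summable_geometric_of_lt_one (norm_nonneg _) hq).mul_left _
  have hm : Multipliable (fun i : ℕ => 1 - a * q ^ i) := by
    simpa [sub_eq_add_neg] using multipliable_one_add_of_summable hs
  exact hm.hasProd.tendsto_prod_nat

/-- The basic hypergeometric series
`₄φ₃ (a₁, a₂, a₃, a₄; b₁, b₂, b₃; q, z)`. -/
def phi43 (a₁ a₂ a₃ a₄ b₁ b₂ b₃ q z : ℂ) : ℂ :=
  ∑' j : ℕ, (qPoch a₁ q j * qPoch a₂ q j * qPoch a₃ q j * qPoch a₄ q j) /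
    (qPoch q q j * qPoch b₁ q j * qPoch b₂ q j * qPoch b₃ q j) * z ^ j

/-- The Askey--Wilson polynomial `p_n(x; a, b, c, d | q)`, `x = (z + z⁻¹) / 2`, as a function
of `z`. The denominators `(ab, ac, ad; q)_j` of the terminating `₄φ₃` are cancelled against the
prefactor `(ab, ac, ad; q)_n`, so that the polynomial is defined for all `b, c, d`;
see `askeyWilsonZ_eq`. -/
def askeyWilsonZ (n : ℕ) (z a b c d q : ℂ) : ℂ :=
  a ^ (-(n : ℤ)) * ∑ j ∈ Finset.range (n + 1),
    (qPoch (q ^ (-(n : ℤ))) q j * qPoch (q ^ ((n : ℤ) - 1) * a * b * c * d) q j *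
      qPoch (a * z) q j * qPoch (a * z⁻¹) q j) / qPoch q q j *
    (qPoch (a * b * q ^ j) q (n - j) * qPoch (a * c * q ^ j) q (n - j) *
      qPoch (a * d * q ^ j) q (n - j)) * q ^ j

/-- A solution `z` of `x = (z + z⁻¹) / 2`. The other one is its inverse. -/
def zOf (x : ℂ) : ℂ := x + (x ^ 2 - 1) ^ (1 / 2 : ℂ)

/-- The Askey--Wilson polynomial `p_n(x; a, b, c, d | q)`. -/
def askeyWilson (n : ℕ) (x a b c d q : ℂ) : ℂ := askeyWilsonZ n (zOf x) a b c d q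

/-- The Askey--Wilson weight `(z^{±2}; q)_∞ / (a z^±, b z^±, c z^±, d z^±; q)_∞`, as a function
of `z`. -/
def awWeightZ (z a b c d q : ℂ) : ℂ :=
  (qPochInf (z ^ 2) q * qPochInf (z⁻¹ ^ 2) q) /
    (qPochInf (a * z) q * qPochInf (a * z⁻¹) q * qPochInf (b * z) q * qPochInf (b * z⁻¹) q *
      qPochInf (c * z) q * qPochInf (c * z⁻¹) q * qPochInf (d * z) q * qPochInf (d * z⁻¹) q)

/-- The Askey--Wilson weight `w(x; a, b, c, d | q)`. -/
def awWeight (x a b c d q : ℂ) : ℂ := awWeightZ (zOf x) a b c d q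

/-- The integrand of `I_{n,k}(a, b, c, d, e, f | q)`. -/
def awIntegrand (n k : ℕ) (a b c d e f q : ℂ) (x : ℝ) : ℂ :=
  askeyWilson n x a b c d q * askeyWilson k x a b e f q * awWeight x a b c f q /
    (Real.sqrt (1 - x ^ 2) : ℂ)

/-- `I_{n,k}(a, b, c, d, e, f | q) =
∫_{-1}^1 p_n(x; a, b, c, d | q) p_k(x; a, b, e, f | q) w(x; a, b, c, f | q) dx / √(1 - x²)`. -/
def awIntegral (n k : ℕ) (a b c d e f q : ℂ) : ℂ :=
  ∫ x in (-1 : ℝ)..1, awIntegrand n k a b c d e f q x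

theorem qPoch_split (a q : ℂ) {j n : ℕ} (h : j ≤ n) :
    qPoch a q j * qPoch (a * q ^ j) q (n - j) = qPoch a q n := by
  obtain ⟨m, rfl⟩ := Nat.exists_eq_add_of_le h
  simp [qPoch, Finset.prod_range_add, pow_add, mul_assoc]

/-- Where the `₄φ₃` makes sense, `askeyWilsonZ` is the usual formula
`a^{-n} (ab, ac, ad; q)_n ₄φ₃ (q^{-n}, q^{n-1}abcd, a z, a z⁻¹; ab, ac, ad; q, q)`. -/
theorem askeyWilsonZ_eq (n : ℕ) (z a b c d q : ℂ) (hq : q ≠ 0)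
    (hb : qPoch (a * b) q n ≠ 0) (hc : qPoch (a * c) q n ≠ 0) (hd : qPoch (a * d) q n ≠ 0) :
    askeyWilsonZ n z a b c d q =
      a ^ (-(n : ℤ)) * (qPoch (a * b) q n * qPoch (a * c) q n * qPoch (a * d) q n) *
        phi43 (q ^ (-(n : ℤ))) (q ^ ((n : ℤ) - 1) * a * b * c * d) (a * z) (a * z⁻¹)
          (a * b) (a * c) (a * d) q q := by
  have h0 : ∀ j ∉ Finset.range (n + 1), qPoch (q ^ (-(n : ℤ))) q j = 0 := by
    intro j hj
    have hj' : n < j := by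
      rw [Finset.mem_range] at hj
      omega
    refine Finset.prod_eq_zero (Finset.mem_range.2 hj') ?_
    simp [hq]
  unfold askeyWilsonZ phi43
  rw [tsum_eq_sum (s := Finset.range (n + 1)) 
    (fun j hj => by rw [h0 j hj]; simp), mul_assoc (a ^ (-(n : ℤ))) _ (Finset.sum _ _),
    Finset.mul_sum _ _ (qPoch (a * b) q n * qPoch (a * c) q n * qPoch (a * d) q n)]
  congr 1
  refine Finset.sum_congr rfl fun j hj => ?_
  have hj' : j ≤ n := by simpa [Nat.lt_succ_iff] using hj
  rw [← qPoch_split (a * b) q hj'] at hb ⊢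
  rw [← qPoch_split (a * c) q hj'] at hc ⊢
  rw [← qPoch_split (a * d) q hj'] at hd ⊢
  have hb' := left_ne_zero_of_mul hb
  have hc' := left_ne_zero_of_mul hc
  have hd' := left_ne_zero_of_mul hd
  by_cases hQ : qPoch q q j = 0
  · simp [hQ]
  · field_simp

theorem askeyWilsonZ_inv (n : ℕ) (z a b c d q : ℂ) :
    askeyWilsonZ n z⁻¹ a b c d q = askeyWilsonZ n z a b c d q := by
  unfold askeyWilsonZ
  congr 1
  refine Finset.sum_congr rfl fun j _ => ?_
  rw [inv_inv]
  ring

theorem awWeightZ_inv (z a b c d q : ℂ) :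
    awWeightZ z⁻¹ a b c d q = awWeightZ z a b c d q := by
  unfold awWeightZ
  rw [inv_inv]
  rw [mul_comm (qPochInf (z⁻¹ ^ 2) q), mul_right_comm _ (qPochInf (d * z⁻¹) q)]
  rw [mul_comm (qPochInf (a * z⁻¹) q)]
  rw [mul_right_comm _ (qPochInf (b * z⁻¹) q), mul_right_comm _ (qPochInf (c * z⁻¹) q)]

theorem zOf_mul (x : ℂ) : zOf x * (x - (x ^ 2 - 1) ^ (1 / 2 : ℂ)) = 1 := by
  have h : ((x ^ 2 - 1) ^ (1 / 2 : ℂ)) ^ 2 = x ^ 2 - 1 := by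
    rw [one_div]
    simp
  unfold zOf
  linear_combination -h

theorem zOf_ne_zero (x : ℂ) : zOf x ≠ 0 := left_ne_zero_of_mul_eq_one (zOf_mul x)

theorem zOf_spec (x : ℂ) : x = (zOf x + (zOf x)⁻¹) / 2 := by
  rw [inv_eq_of_mul_eq_one_right (zOf_mul x)]
  unfold zOf
  ring

theorem zOf_eq (z : ℂ) (hz : z ≠ 0) :
    zOf ((z + z⁻¹) / 2) = z ∨ zOf ((z + z⁻¹) / 2) = z⁻¹ := by
  have h := zOf_spec ((z + z⁻¹) / 2)
  have h0 := zOf_ne_zero ((z + z⁻¹) / 2)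
  generalize zOf ((z + z⁻¹) / 2) = u at h h0
  have h1 : (u - z) * (u * z - 1) = 0 := by
    field_simp at h
    linear_combination -h
  rcases mul_eq_zero.1 h1 with h2 | h2
  · exact Or.inl (sub_eq_zero.1 h2)
  · exact Or.inr (eq_inv_of_mul_eq_one_left (sub_eq_zero.1 h2))

/-- `askeyWilson` at `x = (z + z⁻¹) / 2` is given by the formula in `z`, for either root. -/
theorem askeyWilson_eq (n : ℕ) (z a b c d q : ℂ) (hz : z ≠ 0) :
    askeyWilson n ((z + z⁻¹) / 2) a b c d q = askeyWilsonZ n z a b c d q := by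
  unfold askeyWilson
  rcases zOf_eq z hz with h | h <;> rw [h]
  exact askeyWilsonZ_inv n z a b c d q

/-- `awWeight` at `x = (z + z⁻¹) / 2` is given by the formula in `z`, for either root. -/
theorem awWeight_eq (z a b c d q : ℂ) (hz : z ≠ 0) :
    awWeight ((z + z⁻¹) / 2) a b c d q = awWeightZ z a b c d q := by
  unfold awWeight
  rcases zOf_eq z hz with h | h <;> rw [h]
  exact awWeightZ_inv z a b c d q

end

noncomputable section

/-! The Askey–Wilson polynomials are symmetric in their parameters, so `p_n(x;a,b,c,d)` may be
expanded in the basis `(cz, c/z;q)_j` and `p_k(x;a,b,e,f)` in `(fz, f/z;q)_i`. Multiplying the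
weight `w(x;a,b,c,f)` by such basis elements only replaces `c` by `cq^j` and `f` by `fq^i`. Hence
the integral is a finite double sum of Askey–Wilson integrals, each with a product evaluation
(`circInt_awProdZ`, `awCircInt_eq`). The parameters `d` and `e` occur only in polynomial
coefficients, so no bound on them is needed.

For fixed `j` the sum over `i` is a balanced terminating `₃φ₂`, summed by q-Pfaff–Saalschütz
(`sum_awCoeff_mul_awCircInt`). The remaining sum over `j` is, term by term, the `₄φ₃` of (i)
(`circInt_awProdZ_eq_phi43`). Part (ii) is part (i) after exchanging `n` with `k`, `c` with `f` and
`d` with `e`, which preserves the integral.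

Two classical facts are proved on the way. The symmetry `askeyWilsonZ_swap` follows from Saalschütz,
used both to change the basis and to sum the resulting coefficients. For the Askey–Wilson integral,
Cauchy's theorem on the annulus `q ≤ |z| ≤ 1` gives the first moment of the weight
(`awCircInt_moment`), hence a relation between the integrals at `a` and `aq`. Iterating it sends
each parameter to `0` in turn. The leftover constant, the integral with all parameters zero, is read
off at `(q, -q, √q, -√q)`, where the weight is a trigonometric polynomial. -/

/-! ### Finite q-shifted factorials. -/

@[simp] theorem qPoch_zero (a q : ℂ) : qPoch a q 0 = 1 := by simp [qPoch]

theorem qPoch_succ (a q : ℂ) (n : ℕ) :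
    qPoch a q (n + 1) = qPoch a q n * (1 - a * q ^ n) := by
  simp [qPoch, Finset.prod_range_succ]

theorem qPoch_succ' (a q : ℂ) (n : ℕ) :
    qPoch a q (n + 1) = (1 - a) * qPoch (a * q) q n := by
  simp only [qPoch, Finset.prod_range_succ', pow_succ', pow_zero, mul_one, mul_assoc]
  ring

theorem qPoch_add (a q : ℂ) (m n : ℕ) :
    qPoch a q (m + n) = qPoch a q m * qPoch (a * q ^ m) q n := by
  rw [← qPoch_split a q (Nat.le_add_right m n), Nat.add_sub_cancel_left]

theorem one_sub_mul_pow_ne_zero {a q : ℂ} (hq : ‖q‖ < 1) (ha : ‖a‖ < 1) (n : ℕ) :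
    1 - a * q ^ n ≠ 0 := by
  intro h
  have h1 : ‖a * q ^ n‖ = 1 := by rw [← sub_eq_zero.1 h, norm_one]
  rw [norm_mul, norm_pow] at h1
  have h2 : ‖q‖ ^ n ≤ 1 := pow_le_one₀ (norm_nonneg _) hq.le
  nlinarith [norm_nonneg a, pow_nonneg (norm_nonneg q) n]

theorem qPoch_ne_zero {a q : ℂ} (hq : ‖q‖ < 1) (ha : ‖a‖ < 1) (n : ℕ) : qPoch a q n ≠ 0 :=
  Finset.prod_ne_zero_iff.2 fun i _ => one_sub_mul_pow_ne_zero hq ha i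

/-- Reversal of the order of the factors of a `q`-shifted factorial. -/
theorem qPoch_reverse {y t q : ℂ} {n : ℕ} (hq : q ≠ 0) (h : y * t * q ^ n = q) :
    qPoch y q n = (-y) ^ n * q ^ (n.choose 2) * qPoch t q n := by
  have h1 : q ^ (n.choose 2) = ∏ i ∈ Finset.range n, q ^ (n - 1 - i) := by
    rw [Finset.prod_range_reflect (fun i => q ^ i) n, Finset.prod_pow_eq_pow_sum,
      Finset.sum_range_id, Nat.choose_two_right]
  have h2 : (-y) ^ n = ∏ _i ∈ Finset.range n, (-y) := by simp
  unfold qPoch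
  rw [h1, h2, ← Finset.prod_mul_distrib, ← Finset.prod_mul_distrib,
    ← Finset.prod_range_reflect]
  refine Finset.prod_congr rfl fun i hi => ?_
  have hi' := Finset.mem_range.1 hi
  obtain ⟨m, rfl⟩ : ∃ m, n = i + m + 1 := ⟨n - i - 1, by omega⟩
  have e : i + m + 1 - 1 - i = m := by omega
  rw [e]
  have : y * t * q ^ (i + m) = 1 := by
    apply mul_right_cancel₀ hq
    linear_combination h
  linear_combination -this + (y * t) * (pow_add q i m)

/-! ### Infinite q-shifted factorials. -/

theorem multipliable_one_sub_mul_pow (a : ℂ) {q : ℂ} (hq : ‖q‖ < 1) :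
    Multipliable fun i : ℕ => 1 - a * q ^ i := by
  have hs : Summable (fun i : ℕ => ‖-(a * q ^ i)‖) := by
    simp only [norm_neg, norm_mul, norm_pow]
    exact (summable_geometric_of_lt_one (norm_nonneg _) hq).mul_left _
  simpa [sub_eq_add_neg] using multipliable_one_add_of_summable hs

theorem qPochInf_eq_qPoch_mul (a : ℂ) {q : ℂ} (hq : ‖q‖ < 1) (n : ℕ) :
    qPochInf a q = qPoch a q n * qPochInf (a * q ^ n) q := by
  have h1 := (tendsto_add_atTop_iff_nat n).2 (qPochInf_tendsto a q hq)
  have h2 := (qPochInf_tendsto (a * q ^ n) q hq).const_mul (qPoch a q n)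
  refine tendsto_nhds_unique h1 (h2.congr fun m => ?_)
  rw [← qPoch_add, add_comm]

theorem qPochInf_eq_one_sub_mul (a : ℂ) {q : ℂ} (hq : ‖q‖ < 1) :
    qPochInf a q = (1 - a) * qPochInf (a * q) q := by
  have := qPochInf_eq_qPoch_mul a hq 1
  simpa [qPoch] using this

theorem qPochInf_ne_zero {a q : ℂ} (hq : ‖q‖ < 1) (ha : ‖a‖ < 1) : qPochInf a q ≠ 0 := by
  have := tprod_one_add_ne_zero_of_summable (f := fun i : ℕ => -(a * q ^ i))
    (fun i => by simpa [sub_eq_add_neg] using one_sub_mul_pow_ne_zero hq ha i)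
    (by simp only [norm_neg, norm_mul, norm_pow]
        exact (summable_geometric_of_lt_one (norm_nonneg _) hq).mul_left _)
  simpa [qPochInf, sub_eq_add_neg] using this

/-- On the ball of radius `‖a‖ + 1` the factors differ from 1 by at most a geometric sequence, so
the partial products converge locally uniformly and the limit is holomorphic. Cauchy's theorem will
be applied to quotients of such functions. -/
theorem differentiable_qPochInf {q : ℂ} (hq : ‖q‖ < 1) :
    Differentiable ℂ fun a => qPochInf a q := by
  intro a
  have hs : Summable fun i : ℕ => (‖a‖ + 1) * ‖q‖ ^ i :=
    (summable_geometric_of_lt_one (norm_nonneg _) hq).mul_left _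
  have h := hs.hasProdLocallyUniformlyOn_nat_one_add (K := Metric.ball (0 : ℂ) (‖a‖ + 1))
    (f := fun i a => -(a * q ^ i)) Metric.isOpen_ball
    (.of_forall fun n x hx => by
      rw [norm_neg, norm_mul, norm_pow]
      have : ‖x‖ < ‖a‖ + 1 := by simpa using hx
      gcongr) (fun _ => by fun_prop)
  have hd := h.differentiableOn (.of_forall fun _ => by
    simpa [Finset.prod_fn] using DifferentiableOn.finsetProd (fun _ _ => by fun_prop))
    Metric.isOpen_ball
  have := (hd a (by simp)).differentiableAt (Metric.isOpen_ball.mem_nhds (by simp))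
  simpa [qPochInf, sub_eq_add_neg] using this

theorem continuous_qPochInf {q : ℂ} (hq : ‖q‖ < 1) : Continuous fun a => qPochInf a q :=
  (differentiable_qPochInf hq).continuous

@[simp] theorem qPochInf_zero (q : ℂ) : qPochInf 0 q = 1 := by simp [qPochInf]

theorem norm_sq_lt_one {q : ℂ} (hq : ‖q‖ < 1) : ‖q ^ 2‖ < 1 := by
  rw [norm_pow]; exact pow_lt_one₀ (norm_nonneg _) hq two_ne_zero

theorem qPochInf_sq (x : ℂ) {q : ℂ} (hq : ‖q‖ < 1) :
    qPochInf (x ^ 2) (q ^ 2) = qPochInf x q * qPochInf (-x) q := by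
  unfold qPochInf
  rw [← (multipliable_one_sub_mul_pow x hq).tprod_mul (multipliable_one_sub_mul_pow (-x) hq)]
  congr 1 with i
  ring

theorem qPochInf_even_mul_odd (x : ℂ) {q : ℂ} (hq : ‖q‖ < 1) :
    qPochInf x q = qPochInf x (q ^ 2) * qPochInf (x * q) (q ^ 2) := by
  have h1 : (fun i : ℕ => 1 - x * (q ^ 2) ^ i) = fun i => 1 - x * q ^ (2 * i) := by
    simp only [pow_mul]
  have h2 : (fun i : ℕ => 1 - x * q * (q ^ 2) ^ i) = fun i => 1 - x * q ^ (2 * i + 1) := by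
    simp only [pow_succ, pow_mul, mul_assoc, mul_comm q]
  have m1 := multipliable_one_sub_mul_pow x (norm_sq_lt_one hq)
  have m2 := multipliable_one_sub_mul_pow (x * q) (norm_sq_lt_one hq)
  unfold qPochInf
  rw [h1] at m1 ⊢
  rw [h2] at m2 ⊢
  exact (tprod_even_mul_odd (f := fun i => 1 - x * q ^ i) m1 m2).symm

/-! ### Gaussian binomials and the q-Pfaff–Saalschütz sum. -/

/-- The Gaussian binomial coefficient. -/
def qBinom (q : ℂ) (n i : ℕ) : ℂ :=
  if i ≤ n then qPoch q q n / (qPoch q q i * qPoch q q (n - i)) else 0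

theorem qBinom_add (q : ℂ) (i m : ℕ) :
    qBinom q (i + m) i = qPoch q q (i + m) / (qPoch q q i * qPoch q q m) := by
  simp [qBinom]

theorem qBinom_zero_right {q : ℂ} (hq : ‖q‖ < 1) (n : ℕ) : qBinom q n 0 = 1 := by
  simp [qBinom, div_self (qPoch_ne_zero hq hq n)]

theorem qBinom_self {q : ℂ} (hq : ‖q‖ < 1) (n : ℕ) : qBinom q n n = 1 := by
  simp [qBinom, div_self (qPoch_ne_zero hq hq n)]

/-- Both sides are affine in `t`: the constant terms give one q-Pascal rule and the coefficients of
`t` give the other. -/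
theorem qBinom_pascal {q : ℂ} (hq : ‖q‖ < 1) (i m : ℕ) (t : ℂ) :
    qBinom q (i + m + 2) (i + 1) * (1 - t * q ^ (i + m + 1)) =
      q ^ (m + 1) * qBinom q (i + m + 1) i * (1 - t * q ^ i) +
      qBinom q (i + m + 1) (i + 1) * (1 - t * q ^ (2 * i + m + 2)) := by
  have e1 : i + m + 2 = (i + 1) + (m + 1) := by omega
  have e2 : i + m + 1 = i + (m + 1) := by omega
  have e3 : i + m + 1 = (i + 1) + m := by omega
  have h1 : qBinom q (i + m + 2) (i + 1) =
      qPoch q q (i + m + 1) * (1 - q * q ^ (i + m + 1)) /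
        (qPoch q q i * (1 - q * q ^ i) * (qPoch q q m * (1 - q * q ^ m))) := by
    rw [e1, qBinom_add, ← e1, qPoch_succ, qPoch_succ q q i, qPoch_succ q q m]
  have h2 : qBinom q (i + m + 1) i = qPoch q q (i + m + 1) /
        (qPoch q q i * (qPoch q q m * (1 - q * q ^ m))) := by
    rw [e2, qBinom_add, qPoch_succ q q m]
  have h3 : qBinom q (i + m + 1) (i + 1) = qPoch q q (i + m + 1) /
        (qPoch q q i * (1 - q * q ^ i) * qPoch q q m) := by
    rw [e3, qBinom_add, qPoch_succ q q i]
  rw [h1, h2, h3]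
  have n1 := qPoch_ne_zero hq hq i
  have n2 := qPoch_ne_zero hq hq m
  have n3 := one_sub_mul_pow_ne_zero hq hq i
  have n4 := one_sub_mul_pow_ne_zero hq hq m
  have p1 : q ^ (i + m + 1) = q ^ i * q ^ m * q := by ring
  have p2 : q ^ (2 * i + m + 2) = (q ^ i) ^ 2 * q ^ m * q ^ 2 := by ring
  rw [p1, p2, pow_succ q m]
  generalize q ^ i = u at *
  generalize q ^ m = v at *
  field_simp
  ring

/-- The `q`-Pfaff--Saalschütz sum in polynomial form. -/
theorem qPoch_mul_qPoch_eq_sum {q : ℂ} (hq : ‖q‖ < 1) (s A B : ℂ) (n : ℕ) :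
    qPoch (s * A) q n * qPoch (s * B) q n =
      ∑ i ∈ Finset.range (n + 1), qBinom q n i * s ^ i * qPoch (s * A * B * q ^ i) q (n - i) *
        qPoch s q (n - i) * (qPoch A q i * qPoch B q i) := by
  induction n with
  | zero => simp [qBinom]
  | succ n ih =>
    set K : ℕ → ℕ → ℂ := fun n i =>
      qBinom q n i * s ^ i * qPoch (s * A * B * q ^ i) q (n - i) * qPoch s q (n - i) with hK
    -- The default value 0 of `qBinom` outside the triangle makes the recurrence for `K` valid up to
    -- `i = n` and allows the index shift in `h2`.
    have hK0 : K n (n + 1) = 0 := by simp [hK, qBinom]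
    have hrec0 : K (n + 1) 0 = K n 0 * ((1 - s * q ^ n) * (1 - s * A * B * q ^ n)) := by
      simp only [hK, qBinom_zero_right hq, Nat.sub_zero, qPoch_succ, pow_zero, mul_one]
      ring
    have hrec : ∀ i ∈ Finset.range (n + 1), K (n + 1) (i + 1) = K n i * (s * q ^ (n - i)) +
        K n (i + 1) * ((1 - s * q ^ (n - (i + 1))) * (1 - s * A * B * q ^ (n + (i + 1)))) := by
      intro i hi
      rcases (Nat.lt_succ_iff.1 (Finset.mem_range.1 hi)).eq_or_lt with rfl | h
      · rw [hK0]
        simp [hK, qBinom_self hq, pow_succ]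
      · obtain ⟨m, rfl⟩ : ∃ m, n = i + m + 1 := ⟨n - i - 1, by omega⟩
        have e1 : i + m + 1 + 1 - (i + 1) = m + 1 := by omega
        have e2 : i + m + 1 - i = m + 1 := by omega
        have e3 : i + m + 1 - (i + 1) = m := by omega
        have e4 : s * A * B * q ^ i * q = s * A * B * q ^ (i + 1) := by ring
        simp only [hK, e1, e2, e3]
        rw [qPoch_succ' (s * A * B * q ^ i), e4, qPoch_succ (s * A * B * q ^ (i + 1)),
          qPoch_succ s]
        have := qBinom_pascal hq i m (s * A * B)
        linear_combination (s ^ (i + 1) * qPoch (s * A * B * q ^ (i + 1)) q m * qPoch s q m *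
          (1 - s * q ^ m)) * this
    -- Each term is split by `(1 - sAq^n)(1 - sBq^n) = sq^{n-i}(1 - Aq^i)(1 - Bq^i) + (1 -
    -- sq^{n-i})(1 - sABq^{n+i})`: the first part raises the index `i`, the second keeps it.
    have hL : qPoch (s * A) q (n + 1) * qPoch (s * B) q (n + 1) =
        ∑ i ∈ Finset.range (n + 1), (K n i * (s * q ^ (n - i)) *
            (qPoch A q (i + 1) * qPoch B q (i + 1)) +
          K n i * ((1 - s * q ^ (n - i)) * (1 - s * A * B * q ^ (n + i))) *
            (qPoch A q i * qPoch B q i)) := by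
      rw [qPoch_succ, qPoch_succ, mul_mul_mul_comm, ih, Finset.sum_mul]
      refine Finset.sum_congr rfl fun i hi => ?_
      obtain ⟨m, rfl⟩ := Nat.exists_eq_add_of_le (Nat.lt_succ_iff.1 (Finset.mem_range.1 hi))
      simp only [hK, Nat.add_sub_cancel_left, qPoch_succ]
      ring
    rw [hL, Finset.sum_add_distrib, Finset.sum_range_succ' _ (n + 1)]
    have h2 : ∑ i ∈ Finset.range (n + 1),
          K n i * ((1 - s * q ^ (n - i)) * (1 - s * A * B * q ^ (n + i))) *
            (qPoch A q i * qPoch B q i) =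
        ∑ i ∈ Finset.range (n + 1), K n (i + 1) *
          ((1 - s * q ^ (n - (i + 1))) * (1 - s * A * B * q ^ (n + (i + 1)))) *
            (qPoch A q (i + 1) * qPoch B q (i + 1)) +
        K n 0 * ((1 - s * q ^ n) * (1 - s * A * B * q ^ n)) := by
      rw [Finset.sum_range_succ' _ n, Finset.sum_range_succ _ n, hK0]
      simp
    rw [h2, ← add_assoc, ← Finset.sum_add_distrib]
    congr 1
    · refine Finset.sum_congr rfl fun i hi => ?_
      have := hrec i hi
      simp only [hK] at this ⊢
      rw [this]
      ring
    · rw [← hrec0]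
      simp [hK]

/-- Reversing `(q^{-(j+m)};q)_j` gives `(q^{m+1};q)_j`, which completes `(q;q)_m` to `(q;q)_{j+m}`.
This turns the hypergeometric coefficient into a Gaussian binomial. -/
theorem qPoch_neg_zpow_mul {q : ℂ} (hq0 : q ≠ 0) (j m : ℕ) :
    qPoch (q ^ (-((j + m : ℕ) : ℤ))) q j * qPoch q q m * (q ^ (j + m)) ^ j =
      (-1) ^ j * q ^ (j.choose 2) * qPoch q q (j + m) := by
  rw [zpow_neg, zpow_natCast, qPoch_reverse (t := q * q ^ m) hq0 (by field_simp; ring), add_comm j m,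
    qPoch_add, neg_pow, inv_pow]
  have : (q ^ (m + j)) ^ j ≠ 0 := by positivity
  field_simp

theorem choose_two_add (j m : ℕ) :
    (j + m).choose 2 = j.choose 2 + m.choose 2 + j * m := by
  induction m with
  | zero => simp
  | succ m ih =>
    rw [← add_assoc, Nat.choose_succ_succ' (j + m) 1, Nat.choose_succ_succ' m 1, ih]
    simp; ring

/-- The `q`-Pfaff--Saalschütz sum with the denominators cleared. -/
theorem sum_saalschutz {q : ℂ} (hq0 : q ≠ 0) (hq : ‖q‖ < 1) {A B C D α β : ℂ} (n : ℕ)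
    (hA : A ≠ 0) (hβ : β ≠ 0) (hC : C = A * α) (hD : D = A * β) (hB : B * q = A * α * β * q ^ n) :
    ∑ j ∈ Finset.range (n + 1), qPoch (q ^ (-(n : ℤ))) q j / qPoch q q j * q ^ j *
      (qPoch A q j * qPoch B q j) * (qPoch (C * q ^ j) q (n - j) * qPoch (D * q ^ j) q (n - j)) =
    A ^ n * qPoch α q n * qPoch β q n := by
  have hqn : ∀ m : ℕ, q ^ m ≠ 0 := fun m => pow_ne_zero m hq0
  -- With this `s`, reversal turns `(β;q)_n` into `(sA;q)_n` and `(Dq^j;q)_{n-j}` into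
  -- `(s;q)_{n-j}`, while the balancing condition `hB` becomes `sB = α`. The claim is then the
  -- polynomial form of the sum.
  set s : ℂ := q / (A * β * q ^ n) with hs
  have hsA : β * (s * A) * q ^ n = q := by rw [hs]; field_simp
  have hsB : s * B = α := by
    have h1 : s * B = s * (B * q) / q := by field_simp
    rw [h1, hB, hs]
    field_simp
  have key := qPoch_mul_qPoch_eq_sum hq s A B n
  rw [hsB] at key
  rw [qPoch_reverse hq0 hsA]
  have : A ^ n * qPoch α q n * ((-β) ^ n * q ^ n.choose 2 * qPoch (s * A) q n) =
      A ^ n * (-β) ^ n * q ^ n.choose 2 * (qPoch (s * A) q n * qPoch α q n) := by ring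
  rw [this, key, Finset.mul_sum]
  refine Finset.sum_congr rfl fun j hj => ?_
  obtain ⟨m, rfl⟩ := Nat.exists_eq_add_of_le (Nat.lt_succ_iff.1 (Finset.mem_range.1 hj))
  rw [Nat.add_sub_cancel_left, qBinom_add]
  have e1 : s * A * B * q ^ j = C * q ^ j := by rw [mul_right_comm s, hsB, hC]; ring
  have e2 : qPoch (D * q ^ j) q m = (-(D * q ^ j)) ^ m * q ^ (m.choose 2) * qPoch s q m := by
    refine qPoch_reverse hq0 ?_
    rw [hD, hs, pow_add]
    field_simp
  have e3 := qPoch_neg_zpow_mul hq0 j m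
  have e4 : qPoch (q ^ (-((j + m : ℕ) : ℤ))) q j =
      (-1) ^ j * q ^ (j.choose 2) * qPoch q q (j + m) / (qPoch q q m * (q ^ (j + m)) ^ j) := by
    rw [eq_div_iff (mul_ne_zero (qPoch_ne_zero hq hq m) (pow_ne_zero _ (hqn _))), ← e3]
    ring
  rw [e1, e2, e4, choose_two_add, hD, hs]
  have n1 := qPoch_ne_zero hq hq m
  have n2 := qPoch_ne_zero hq hq j
  have h5 : (-(A * β * q ^ j)) ^ m = (-1) ^ m * A ^ m * β ^ m * q ^ (j * m) := by
    rw [neg_pow, mul_pow, mul_pow, ← pow_mul]; ring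
  have h6 : (-β) ^ (j + m) = (-1) ^ j * (-1) ^ m * β ^ j * β ^ m := by
    rw [neg_pow]; ring
  rw [h5, h6, div_pow, mul_pow, mul_pow, pow_add A]
  have n3 : (q ^ (j + m)) ^ j ≠ 0 := pow_ne_zero _ (hqn _)
  have n4 : A ^ j ≠ 0 := pow_ne_zero _ hA
  have n5 : β ^ j ≠ 0 := pow_ne_zero _ hβ
  generalize (q ^ (j + m)) ^ j = u at *
  field_simp
  ring

/-! ### Parameter symmetry of the Askey–Wilson polynomials. -/

set_option maxHeartbeats 1000000 in
/-- The Askey--Wilson polynomials are symmetric in `a` and `c`. -/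
theorem askeyWilsonZ_swap {q : ℂ} (hq0 : q ≠ 0) (hq : ‖q‖ < 1) (n : ℕ) {z a c d : ℂ} (b : ℂ)
    (hz : z ≠ 0) (ha : a ≠ 0) (hc : c ≠ 0) (hd : d ≠ 0) :
    askeyWilsonZ n z a b c d q = askeyWilsonZ n z c b a d q := by
  have hqn : ∀ m : ℕ, q ^ m ≠ 0 := fun m => pow_ne_zero m hq0
  obtain ⟨s, hs⟩ : ∃ s, s = a / c := ⟨_, rfl⟩
  obtain ⟨T, hT⟩ : ∃ T, T = q ^ ((n : ℤ) - 1) * a * b * c * d := ⟨_, rfl⟩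
  have hTq : T * q = a * b * c * d * q ^ n := by
    rw [hT, zpow_sub_one₀ hq0, zpow_natCast]
    field_simp
  have hT' : q ^ ((n : ℤ) - 1) * c * b * a * d = T := by rw [hT]; ring
  -- Change of basis from `(az, a/z)_j` to `(cz, c/z)_i`: the polynomial Saalschütz sum with scaling
  -- factor `s = a/c`.
  have key : ∀ j, qPoch (a * z) q j * qPoch (a * z⁻¹) q j = ∑ i ∈ Finset.Ico 0 (j + 1),
      qBinom q j i * s ^ i * qPoch (a * c * q ^ i) q (j - i) * qPoch s q (j - i) *
        (qPoch (c * z) q i * qPoch (c * z⁻¹) q i) := by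
    intro j
    have h1 : a * z = s * (c * z) := by rw [hs]; field_simp
    have h2 : a * z⁻¹ = s * (c * z⁻¹) := by rw [hs]; field_simp
    have h3 : a * c = s * (c * z) * (c * z⁻¹) := by rw [hs]; field_simp
    rw [h1, h2, h3, qPoch_mul_qPoch_eq_sum hq, Finset.range_eq_Ico]
  unfold askeyWilsonZ
  rw [hT', ← hT]
  have hL : ∀ j, (qPoch (q ^ (-(n : ℤ))) q j * qPoch T q j *
      qPoch (a * z) q j * qPoch (a * z⁻¹) q j) / qPoch q q j *
    (qPoch (a * b * q ^ j) q (n - j) * qPoch (a * c * q ^ j) q (n - j) *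
      qPoch (a * d * q ^ j) q (n - j)) * q ^ j =
      ∑ i ∈ Finset.Ico 0 (j + 1), (qPoch (q ^ (-(n : ℤ))) q j * qPoch T q j / qPoch q q j *
    (qPoch (a * b * q ^ j) q (n - j) * qPoch (a * c * q ^ j) q (n - j) *
      qPoch (a * d * q ^ j) q (n - j)) * q ^ j) * (qBinom q j i * s ^ i *
        qPoch (a * c * q ^ i) q (j - i) * qPoch s q (j - i) *
        (qPoch (c * z) q i * qPoch (c * z⁻¹) q i)) := by
    intro j
    rw [← Finset.mul_sum, ← key]
    ring
  simp only [hL]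
  rw [Finset.range_eq_Ico, ← Finset.sum_Ico_Ico_comm, Finset.mul_sum, Finset.mul_sum]
  refine Finset.sum_congr rfl fun i hi => ?_
  obtain ⟨N, rfl⟩ := Nat.exists_eq_add_of_le (Nat.lt_succ_iff.1 (Finset.mem_Ico.1 hi).2)
  -- After exchanging the sums, the coefficient of `(cz, c/z)_i` is a second balanced sum, in `m = j
  -- - i`.
  have saal := sum_saalschutz hq0 hq (A := s) (B := T * q ^ i) (C := a * b * q ^ i)
    (D := a * d * q ^ i) (α := b * c * q ^ i) (β := c * d * q ^ i) N
    (hs ▸ div_ne_zero ha hc) (mul_ne_zero (mul_ne_zero hc hd) (hqn i))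
    (by rw [hs]; field_simp) (by rw [hs]; field_simp)
    (by rw [mul_right_comm, hTq, hs, pow_add]; field_simp)
  have hneg : q ^ (-((i + N : ℕ) : ℤ)) * q ^ i = q ^ (-(N : ℤ)) := by
    rw [zpow_neg, zpow_neg, zpow_natCast, zpow_natCast, pow_add]
    have := hqn i
    have := hqn N
    field_simp
  rw [Finset.sum_Ico_eq_sum_range, show i + N + 1 - i = N + 1 by omega]
  have hsum : ∀ m ∈ Finset.range (N + 1),
      (qPoch (q ^ (-((i + N : ℕ) : ℤ))) q (i + m) * qPoch T q (i + m) / qPoch q q (i + m) *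
    (qPoch (a * b * q ^ (i + m)) q (i + N - (i + m)) *
      qPoch (a * c * q ^ (i + m)) q (i + N - (i + m)) *
      qPoch (a * d * q ^ (i + m)) q (i + N - (i + m))) * q ^ (i + m)) *
      (qBinom q (i + m) i * s ^ i *
        qPoch (a * c * q ^ i) q (i + m - i) * qPoch s q (i + m - i) *
        (qPoch (c * z) q i * qPoch (c * z⁻¹) q i)) =
      (qPoch (q ^ (-((i + N : ℕ) : ℤ))) q i * qPoch T q i / qPoch q q i * q ^ i * s ^ i *
        qPoch (a * c * q ^ i) q N * (qPoch (c * z) q i * qPoch (c * z⁻¹) q i)) *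
      (qPoch (q ^ (-(N : ℤ))) q m / qPoch q q m * q ^ m *
      (qPoch s q m * qPoch (T * q ^ i) q m) *
      (qPoch (a * b * q ^ i * q ^ m) q (N - m) * qPoch (a * d * q ^ i * q ^ m) q (N - m))) := by
    intro m hm
    rw [qBinom_add, Nat.add_sub_cancel_left, show i + N - (i + m) = N - m by omega,
      qPoch_add _ q i m, qPoch_add T q i m, hneg,
      ← qPoch_split (a * c * q ^ i) q (Nat.lt_succ_iff.1 (Finset.mem_range.1 hm))]
    have n1 := qPoch_ne_zero hq hq i
    have n2 := qPoch_ne_zero hq hq m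
    have n3 := qPoch_ne_zero hq hq (i + m)
    have p1 : ∀ x : ℂ, x * q ^ (i + m) = x * q ^ i * q ^ m := fun x => by ring
    rw [p1 (a * b), p1 (a * c), p1 (a * d), pow_add q i m]
    generalize qPoch (q ^ (-((i + N : ℕ) : ℤ))) q i = X1
    generalize qPoch (q ^ (-(N : ℤ))) q m = X2
    generalize qPoch (a * b * q ^ i * q ^ m) q (N - m) = X3
    generalize qPoch (a * c * q ^ i * q ^ m) q (N - m) = X4
    generalize qPoch (a * d * q ^ i * q ^ m) q (N - m) = X5
    generalize qPoch (a * c * q ^ i) q m = X6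
    generalize qPoch q q i = Y1 at *
    generalize qPoch q q m = Y2 at *
    generalize qPoch q q (i + m) = Y3 at *
    generalize qPoch T q i = X7
    generalize qPoch (T * q ^ i) q m = X8
    generalize qPoch s q m = X9
    generalize qPoch (c * z) q i = X10
    generalize qPoch (c * z⁻¹) q i = X11
    linear_combination (X1 * X2 * (X7 * X8) * (X3 * X4 * X5) * (q ^ i * q ^ m) * s ^ i * X6 * X9 *
      (X10 * X11) * Y1⁻¹ * Y2⁻¹) * mul_inv_cancel₀ n3
  rw [Finset.sum_congr rfl hsum, ← Finset.mul_sum, saal, Nat.add_sub_cancel_left]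
  have e1 : a ^ (-((i + N : ℕ) : ℤ)) * (s ^ i * s ^ N) = c ^ (-((i + N : ℕ) : ℤ)) := by
    rw [← pow_add, hs, zpow_neg, zpow_neg, zpow_natCast, zpow_natCast, div_pow]
    have := pow_ne_zero (i + N) ha
    field_simp
  rw [← e1, mul_comm c b, mul_comm c a]
  ring

/-! ### Integration over the unit circle. -/

/-- The integral of `f` over the unit circle with respect to the angle. -/
def circInt (f : ℂ → ℂ) : ℂ := ∫ θ in (0 : ℝ)..2 * Real.pi, f (circleMap 0 1 θ)

theorem norm_circleMap_one (θ : ℝ) : ‖circleMap 0 1 θ‖ = 1 := by simp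

theorem circInt_congr {f g : ℂ → ℂ} (h : ∀ z, ‖z‖ = 1 → f z = g z) : circInt f = circInt g := by
  unfold circInt
  simp only [h _ (norm_circleMap_one _)]

theorem circInt_inv (f : ℂ → ℂ) : circInt (fun z => f z⁻¹) = circInt f := by
  unfold circInt
  have h := intervalIntegral.integral_comp_sub_left (a := 0) (b := 2 * Real.pi)
    (fun θ : ℝ => f (circleMap 0 1 θ)) (2 * Real.pi)
  simp only [sub_self, sub_zero] at h
  rw [← h]
  congr 1 with θ
  simp [circleMap, sub_mul, Complex.exp_sub]

theorem circInt_const_mul (c : ℂ) (f : ℂ → ℂ) : circInt (fun z => c * f z) = c * circInt f :=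
  intervalIntegral.integral_const_mul _ _

theorem continuous_comp_circleMap {f : ℂ → ℂ} (hf : ∀ z, ‖z‖ = 1 → ContinuousAt f z) :
    Continuous fun θ : ℝ => f (circleMap 0 1 θ) :=
  continuous_iff_continuousAt.2 fun θ => ContinuousAt.comp (f := circleMap 0 1) (g := f)
    (hf _ (norm_circleMap_one θ)) (continuous_circleMap 0 1).continuousAt

theorem circInt_add {f g : ℂ → ℂ} (hf : ∀ z, ‖z‖ = 1 → ContinuousAt f z)
    (hg : ∀ z, ‖z‖ = 1 → ContinuousAt g z) :
    circInt (fun z => f z + g z) = circInt f + circInt g :=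
  intervalIntegral.integral_add ((continuous_comp_circleMap hf).intervalIntegrable _ _)
    ((continuous_comp_circleMap hg).intervalIntegrable _ _)

theorem circInt_sum {f : ℕ → ℂ → ℂ} (s : Finset ℕ)
    (hf : ∀ i ∈ s, ∀ z, ‖z‖ = 1 → ContinuousAt (f i) z) :
    circInt (fun z => ∑ i ∈ s, f i z) = ∑ i ∈ s, circInt (f i) :=
  intervalIntegral.integral_finsetSum fun i hi =>
    (continuous_comp_circleMap (hf i hi)).intervalIntegrable _ _

/-- On a circle about the origin, `dz/z = i dθ`. -/
theorem circleIntegral_inv_mul (f : ℂ → ℂ) {r : ℝ} (hr : 0 < r) :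
    (∮ z in C(0, r), (z - 0)⁻¹ • f z) = Complex.I * circInt fun z => f (r * z) := by
  unfold circleIntegral circInt
  rw [← intervalIntegral.integral_const_mul]
  congr 1 with θ
  have h : circleMap 0 r θ = r * circleMap 0 1 θ := by simp [circleMap]
  have h1 : circleMap 0 r θ ≠ 0 := circleMap_ne_center hr.ne'
  simp only [deriv_circleMap, sub_zero, ← h, smul_eq_mul]
  field_simp

/-- Cauchy's theorem on the annulus `r ≤ ‖z‖ ≤ 1`. -/
theorem circInt_eq_of_annulus {f : ℂ → ℂ} {r : ℝ} (hr0 : 0 < r) (hr1 : r ≤ 1)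
    (hf : ∀ z, r ≤ ‖z‖ → ‖z‖ ≤ 1 → DifferentiableAt ℂ f z) :
    circInt f = circInt fun z => f (r * z) := by
  have h := Complex.circleIntegral_sub_center_inv_smul_eq_of_differentiable_on_annulus_off_countable
    (c := 0) (f := f) hr0 hr1 Set.countable_empty
    (fun z hz => (hf z (by simpa using hz.2) (by simpa using hz.1)).continuousAt.continuousWithinAt)
    (fun z hz => hf z (by simpa using (le_of_lt (by simpa using hz.1.2)))
      (by simpa using (le_of_lt (by simpa using hz.1.1))))
  rw [circleIntegral_inv_mul _ one_pos, circleIntegral_inv_mul _ hr0] at h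
  simpa using h

/-! ### The weight and the contour function behind its first moment. -/

theorem norm_mul_lt_one {s z : ℂ} (hs : ‖s‖ < 1) (hz : ‖z‖ ≤ 1) : ‖s * z‖ < 1 := by
  rw [norm_mul]
  nlinarith [norm_nonneg s, norm_nonneg z]

theorem awWeightZ_continuousAt {q a b c d z : ℂ} (hq : ‖q‖ < 1) (ha : ‖a‖ < 1) (hb : ‖b‖ < 1)
    (hc : ‖c‖ < 1) (hd : ‖d‖ < 1) (hz : ‖z‖ = 1) :
    ContinuousAt (fun z => awWeightZ z a b c d q) z := by
  have hz0 : z ≠ 0 := by rintro rfl; simp at hz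
  have hzi : ‖z⁻¹‖ ≤ 1 := by simp [hz]
  have hp := continuous_qPochInf hq
  have h1 : ∀ s, ContinuousAt (fun z => qPochInf (s * z) q) z := fun s =>
    hp.continuousAt.comp (f := fun z => s * z) (by fun_prop)
  have h2 : ∀ s, ContinuousAt (fun z => qPochInf (s * z⁻¹) q) z := fun s =>
    hp.continuousAt.comp (f := fun z => s * z⁻¹) (by fun_prop (disch := assumption))
  have h3 : ContinuousAt (fun z => qPochInf (z ^ 2) q) z :=
    hp.continuousAt.comp (f := fun z => z ^ 2) (by fun_prop)
  have h4 : ContinuousAt (fun z => qPochInf (z⁻¹ ^ 2) q) z :=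
    hp.continuousAt.comp (f := fun z => z⁻¹ ^ 2) (by fun_prop (disch := assumption))
  unfold awWeightZ
  refine (h3.mul h4).div ?_ ?_
  · exact ((((((((h1 a).mul (h2 a)).mul (h1 b)).mul (h2 b)).mul (h1 c)).mul (h2 c)).mul
      (h1 d)).mul (h2 d))
  · have e1 : ∀ s, ‖s‖ < 1 → qPochInf (s * z) q ≠ 0 := fun s hs =>
      qPochInf_ne_zero hq (norm_mul_lt_one hs hz.le)
    have e2 : ∀ s, ‖s‖ < 1 → qPochInf (s * z⁻¹) q ≠ 0 := fun s hs =>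
      qPochInf_ne_zero hq (norm_mul_lt_one hs hzi)
    simp [e1, e2, ha, hb, hc, hd]

/-- The function whose contour integrals over `‖z‖ = 1` and `‖z‖ = q` are compared. -/
def awAux (a b c d q z : ℂ) : ℂ :=
  z * (qPochInf (z ^ 2) q * qPochInf (q * z⁻¹ ^ 2) q) /
    (qPochInf (a * z) q * qPochInf (a * q * z⁻¹) q * qPochInf (b * z) q * qPochInf (b * q * z⁻¹) q *
      qPochInf (c * z) q * qPochInf (c * q * z⁻¹) q * qPochInf (d * z) q * qPochInf (d * q * z⁻¹) q)

/-- The zeros of `(sz;q)_∞` lie in `|z| > 1` and those of `(sq/z;q)_∞` in `|z| < q`, so the closed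
annulus contains no pole. -/
theorem awAux_differentiableAt {q : ℝ} (hq0 : 0 < q) (hq1 : q < 1) {a b c d z : ℂ} (ha : ‖a‖ < 1)
    (hb : ‖b‖ < 1) (hc : ‖c‖ < 1) (hd : ‖d‖ < 1) (hqz : q ≤ ‖z‖) (hz : ‖z‖ ≤ 1) :
    DifferentiableAt ℂ (awAux a b c d q) z := by
  have hq : ‖(q : ℂ)‖ < 1 := by simpa [abs_of_pos hq0] using hq1
  have hz0 : z ≠ 0 := by rintro rfl; simp at hqz; linarith
  have hzi : ‖(q : ℂ) * z⁻¹‖ ≤ 1 := by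
    rw [norm_mul, norm_inv, Complex.norm_real, Real.norm_of_nonneg hq0.le, ← div_eq_mul_inv]
    exact div_le_one_of_le₀ hqz (norm_nonneg _)
  have hp := differentiable_qPochInf hq
  have h1 : ∀ s, DifferentiableAt ℂ (fun z => qPochInf (s * z) q) z := fun s =>
    (hp (s * z)).comp z (f := fun z => s * z) (by fun_prop)
  have h2 : ∀ s, DifferentiableAt ℂ (fun z => qPochInf (s * z⁻¹) q) z := fun s =>
    (hp (s * z⁻¹)).comp z (f := fun z => s * z⁻¹) (by fun_prop (disch := assumption))
  have h3 : DifferentiableAt ℂ (fun z => qPochInf (z ^ 2) q) z :=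
    (hp (z ^ 2)).comp z (f := fun z => z ^ 2) (by fun_prop)
  have h4 : DifferentiableAt ℂ (fun z => qPochInf (q * z⁻¹ ^ 2) q) z :=
    (hp (q * z⁻¹ ^ 2)).comp z (f := fun z : ℂ => (q : ℂ) * z⁻¹ ^ 2) (by fun_prop (disch := assumption))
  unfold awAux
  refine (differentiableAt_id.mul (h3.mul h4)).div ?_ ?_
  · exact ((((((((h1 a).mul (h2 _)).mul (h1 b)).mul (h2 _)).mul (h1 c)).mul (h2 _)).mul
      (h1 d)).mul (h2 _))
  · have e1 : ∀ s, ‖s‖ < 1 → qPochInf (s * z) q ≠ 0 := fun s hs =>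
      qPochInf_ne_zero hq (norm_mul_lt_one hs hz)
    have e2 : ∀ s, ‖s‖ < 1 → qPochInf (s * q * z⁻¹) q ≠ 0 := fun s hs =>
      qPochInf_ne_zero hq (by rw [mul_assoc]; exact norm_mul_lt_one hs hzi)
    simp [e1, e2, ha, hb, hc, hd]

/-- The denominators at `qz` and `1/z` agree. The numerators differ by one factor at each end, and
`qz(1 - q⁻¹z⁻²) = -z⁻¹(1 - qz²)` supplies the sign. -/
theorem awAux_mul {q : ℝ} (hq0 : 0 < q) (hq1 : q < 1) (a b c d : ℂ) {z : ℂ} (hz : z ≠ 0) :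
    awAux a b c d q (q * z) = -awAux a b c d q z⁻¹ := by
  have hq : ‖(q : ℂ)‖ < 1 := by simpa [abs_of_pos hq0] using hq1
  have hqc : (q : ℂ) ≠ 0 := by exact_mod_cast hq0.ne'
  have e1 : ∀ s : ℂ, s * q * (q * z)⁻¹ = s * z⁻¹ := fun s => by field_simp
  have e2 : ∀ s : ℂ, s * (q * z) = s * q * z := fun s => by ring
  have e3 : (q : ℂ) * (q * z)⁻¹ ^ 2 = (q : ℂ)⁻¹ * z⁻¹ ^ 2 := by field_simp
  have e4 : qPochInf ((q : ℂ)⁻¹ * z⁻¹ ^ 2) q =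
      (1 - (q : ℂ)⁻¹ * z⁻¹ ^ 2) * qPochInf (z⁻¹ ^ 2) q := by
    rw [qPochInf_eq_one_sub_mul _ hq]
    congr 2
    field_simp
  have e5 : qPochInf (q * z ^ 2) q = (1 - q * z ^ 2) * qPochInf ((q * z) ^ 2) q := by
    rw [qPochInf_eq_one_sub_mul _ hq]
    congr 2
    ring
  unfold awAux
  simp only [e1, e2, inv_inv, e3, e4, e5]
  rw [← neg_div]
  congr 1
  · field_simp
    ring
  · ring

/-- Moving the contour to `|z| = q`, applying `awAux_mul` and inverting `z` shows that the integral
equals its own negative. -/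
theorem circInt_awAux {q : ℝ} (hq0 : 0 < q) (hq1 : q < 1) {a b c d : ℂ} (ha : ‖a‖ < 1)
    (hb : ‖b‖ < 1) (hc : ‖c‖ < 1) (hd : ‖d‖ < 1) : circInt (awAux a b c d q) = 0 := by
  have h := circInt_eq_of_annulus hq0 hq1.le (f := awAux a b c d q)
    fun z h1 h2 => awAux_differentiableAt hq0 hq1 ha hb hc hd h1 h2
  rw [circInt_congr (g := fun z => -1 * awAux a b c d q z⁻¹)
    (f := fun z => awAux a b c d q (q * z)), circInt_const_mul, circInt_inv] at h
  · linear_combination h / 2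
  · intro z hz
    rw [awAux_mul hq0 hq1 _ _ _ _ (by rintro rfl; simp at hz)]
    ring

theorem awAux_add_inv {q a b c d z : ℂ} (hq : ‖q‖ < 1) (ha : ‖a‖ < 1)
    (hb : ‖b‖ < 1) (hc : ‖c‖ < 1) (hd : ‖d‖ < 1) (hz : ‖z‖ = 1) :
    awAux a b c d q z + awAux a b c d q z⁻¹ = awWeightZ z a b c d q *
      ((1 - a * b * c * d) * (z + z⁻¹) -
        (a + b + c + d - (a * b * c + a * b * d + a * c * d + b * c * d))) := by
  have hz0 : z ≠ 0 := by rintro rfl; simp at hz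
  have hzi : ‖z⁻¹‖ ≤ 1 := by simp [hz]
  have f1 : ∀ s, qPochInf (s * z) q = (1 - s * z) * qPochInf (s * q * z) q := fun s => by
    rw [qPochInf_eq_one_sub_mul _ hq, mul_right_comm]
  have f2 : ∀ s, qPochInf (s * z⁻¹) q = (1 - s * z⁻¹) * qPochInf (s * q * z⁻¹) q := fun s => by
    rw [qPochInf_eq_one_sub_mul _ hq, mul_right_comm]
  have f3 : qPochInf (z ^ 2) q = (1 - z ^ 2) * qPochInf (q * z ^ 2) q := by
    rw [qPochInf_eq_one_sub_mul _ hq, mul_comm q]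
  have f4 : qPochInf (z⁻¹ ^ 2) q = (1 - z⁻¹ ^ 2) * qPochInf (q * z⁻¹ ^ 2) q := by
    rw [qPochInf_eq_one_sub_mul _ hq, mul_comm q]
  have n1 : ∀ s, ‖s‖ < 1 → 1 - s * z ≠ 0 ∧ qPochInf (s * q * z) q ≠ 0 := fun s hs =>
    mul_ne_zero_iff.1 (f1 s ▸ qPochInf_ne_zero hq (norm_mul_lt_one hs hz.le))
  have n2 : ∀ s, ‖s‖ < 1 → 1 - s * z⁻¹ ≠ 0 ∧ qPochInf (s * q * z⁻¹) q ≠ 0 := fun s hs =>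
    mul_ne_zero_iff.1 (f2 s ▸ qPochInf_ne_zero hq (norm_mul_lt_one hs hzi))
  obtain ⟨a1, a2⟩ := n1 a ha
  obtain ⟨a3, a4⟩ := n2 a ha
  obtain ⟨b1, b2⟩ := n1 b hb
  obtain ⟨b3, b4⟩ := n2 b hb
  obtain ⟨c1, c2⟩ := n1 c hc
  obtain ⟨c3, c4⟩ := n2 c hc
  obtain ⟨d1, d2⟩ := n1 d hd
  obtain ⟨d3, d4⟩ := n2 d hd
  -- The factor `(1 - z²)(1 - z⁻²)` of the weight stays inside the identity instead of being divided
  -- out, since it vanishes at `z = ±1` on the circle.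
  have hpoly : (1 - z ^ 2) * (1 - z⁻¹ ^ 2) * ((1 - a * b * c * d) * (z + z⁻¹) -
        (a + b + c + d - (a * b * c + a * b * d + a * c * d + b * c * d))) =
      z * (1 - z ^ 2) * ((1 - a * z⁻¹) * (1 - b * z⁻¹) * (1 - c * z⁻¹) * (1 - d * z⁻¹)) +
      z⁻¹ * (1 - z⁻¹ ^ 2) * ((1 - a * z) * (1 - b * z) * (1 - c * z) * (1 - d * z)) := by
    field_simp
    ring
  unfold awAux awWeightZ
  simp only [inv_inv, f1 a, f1 b, f1 c, f1 d, f2 a, f2 b, f2 c, f2 d, f3, f4]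
  generalize hw : z⁻¹ = w at *
  generalize qPochInf (a * q * z) q = A1 at *
  generalize qPochInf (a * q * w) q = A2 at *
  generalize qPochInf (b * q * z) q = B1 at *
  generalize qPochInf (b * q * w) q = B2 at *
  generalize qPochInf (c * q * z) q = C1 at *
  generalize qPochInf (c * q * w) q = C2 at *
  generalize qPochInf (d * q * z) q = D1 at *
  generalize qPochInf (d * q * w) q = D2 at *
  generalize qPochInf (q * z ^ 2) q = Z1 at *
  generalize qPochInf (q * w ^ 2) q = Z2 at *
  trans (Z1 * Z2) / ((1 - a * z) * A1 * ((1 - a * w) * A2) * ((1 - b * z) * B1) *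
    ((1 - b * w) * B2) * ((1 - c * z) * C1) * ((1 - c * w) * C2) * ((1 - d * z) * D1) *
    ((1 - d * w) * D2)) * (z * (1 - z ^ 2) * ((1 - a * w) * (1 - b * w) * (1 - c * w) *
    (1 - d * w)) + w * (1 - w ^ 2) * ((1 - a * z) * (1 - b * z) * (1 - c * z) * (1 - d * z)))
  · rw [mul_add]
    congr 1
    · field_simp
    · field_simp
  · rw [← hpoly]
    ring

/-! ### Evaluation of the Askey–Wilson integral. -/

/-- The Askey--Wilson integral over the unit circle. -/
def awCircInt (a b c d q : ℂ) : ℂ := circInt fun z => awWeightZ z a b c d q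

theorem awWeightZ_swap_ab (z a b c d q : ℂ) : awWeightZ z a b c d q = awWeightZ z b a c d q := by
  unfold awWeightZ
  congr 1
  ring

theorem awWeightZ_swap_ac (z a b c d q : ℂ) : awWeightZ z a b c d q = awWeightZ z c b a d q := by
  unfold awWeightZ
  congr 1
  ring

theorem awWeightZ_swap_cd (z a b c d q : ℂ) : awWeightZ z a b c d q = awWeightZ z a b d c q := by
  unfold awWeightZ
  congr 1
  ring

theorem norm_mul_pow_lt_one {s q : ℂ} (hq : ‖q‖ < 1) (hs : ‖s‖ < 1) (n : ℕ) : ‖s * q ^ n‖ < 1 :=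
  norm_mul_lt_one hs (by rw [norm_pow]; exact pow_le_one₀ (norm_nonneg _) hq.le)

theorem awWeightZ_mul_pow {q z a : ℂ} (hq : ‖q‖ < 1) (ha : ‖a‖ < 1) (hz : ‖z‖ = 1) (b c d : ℂ)
    (n : ℕ) : awWeightZ z (a * q ^ n) b c d q =
      awWeightZ z a b c d q * (qPoch (a * z) q n * qPoch (a * z⁻¹) q n) := by
  have hzi : ‖z⁻¹‖ ≤ 1 := by simp [hz]
  have h1 := qPochInf_eq_qPoch_mul (a * z) hq n
  have h2 := qPochInf_eq_qPoch_mul (a * z⁻¹) hq n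
  have n1 := qPochInf_ne_zero hq (norm_mul_lt_one ha hz.le)
  have n2 := qPochInf_ne_zero hq (norm_mul_lt_one ha hzi)
  rw [h1] at n1
  rw [h2] at n2
  have m1 := left_ne_zero_of_mul n1
  have m2 := left_ne_zero_of_mul n2
  unfold awWeightZ
  rw [h1, h2, mul_right_comm a _ z, mul_right_comm a _ z⁻¹]
  generalize qPochInf (a * z * q ^ n) q = A
  generalize qPochInf (a * z⁻¹ * q ^ n) q = B
  have : ∀ R : ℂ, R / ((qPoch (a * z) q n * A) * (qPoch (a * z⁻¹) q n * B) *
      qPochInf (b * z) q * qPochInf (b * z⁻¹) q *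
      qPochInf (c * z) q * qPochInf (c * z⁻¹) q * qPochInf (d * z) q * qPochInf (d * z⁻¹) q) =
      R / (qPoch (a * z) q n * qPoch (a * z⁻¹) q n) / (A * B *
      qPochInf (b * z) q * qPochInf (b * z⁻¹) q *
      qPochInf (c * z) q * qPochInf (c * z⁻¹) q * qPochInf (d * z) q * qPochInf (d * z⁻¹) q) := by
    intro R
    rw [div_div]
    congr 1
    ring
  rw [this, div_mul_eq_mul_div, div_mul_cancel₀ _ (mul_ne_zero m1 m2)]

theorem awCircInt_moment {q : ℝ} (hq0 : 0 < q) (hq1 : q < 1) {a b c d : ℂ} (ha : ‖a‖ < 1)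
    (hb : ‖b‖ < 1) (hc : ‖c‖ < 1) (hd : ‖d‖ < 1) :
    circInt (fun z => awWeightZ z a b c d q *
      ((1 - a * b * c * d) * (z + z⁻¹) -
        (a + b + c + d - (a * b * c + a * b * d + a * c * d + b * c * d)))) = 0 := by
  have hq : ‖(q : ℂ)‖ < 1 := by simpa [abs_of_pos hq0] using hq1
  have hcont : ∀ z : ℂ, ‖z‖ = 1 → ContinuousAt (awAux a b c d q) z := fun z hz =>
    (awAux_differentiableAt hq0 hq1 ha hb hc hd (hz ▸ hq1.le) hz.le).continuousAt
  rw [← circInt_congr (fun z hz => awAux_add_inv hq ha hb hc hd hz), circInt_add hcont,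
    circInt_inv, circInt_awAux hq0 hq1 ha hb hc hd, add_zero]
  intro z hz
  have hz0 : z ≠ 0 := by rintro rfl; simp at hz
  exact (hcont z⁻¹ (by simp [hz])).comp (f := fun z => z⁻¹) (by fun_prop (disch := assumption))

/-- Passing from `a` to `aq` multiplies the weight by `(1 - az)(1 - a/z)`, which is affine in `z +
1/z`. Up to the factor `1 - abcd`, it is a constant plus `-a` times the polynomial of
`awCircInt_moment`, whose integral vanishes. -/
theorem awCircInt_shift {q : ℝ} (hq0 : 0 < q) (hq1 : q < 1) {a b c d : ℂ} (ha : ‖a‖ < 1)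
    (hb : ‖b‖ < 1) (hc : ‖c‖ < 1) (hd : ‖d‖ < 1) :
    (1 - a * b * c * d) * awCircInt (a * q) b c d q =
      (1 - a * b) * (1 - a * c) * (1 - a * d) * awCircInt a b c d q := by
  have hq : ‖(q : ℂ)‖ < 1 := by simpa [abs_of_pos hq0] using hq1
  have hw : ∀ z : ℂ, ‖z‖ = 1 → ContinuousAt (fun z => awWeightZ z a b c d q) z := fun z hz =>
    awWeightZ_continuousAt hq ha hb hc hd hz
  unfold awCircInt
  rw [← circInt_const_mul, ← circInt_const_mul]
  have h := awCircInt_moment hq0 hq1 ha hb hc hd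
  have h2 : circInt (fun z => (1 - a * b * c * d) * awWeightZ z (a * q) b c d q) =
      circInt (fun z => (1 - a * b) * (1 - a * c) * (1 - a * d) * awWeightZ z a b c d q +
        (-a) * (awWeightZ z a b c d q * ((1 - a * b * c * d) * (z + z⁻¹) -
        (a + b + c + d - (a * b * c + a * b * d + a * c * d + b * c * d))))) := by
    refine circInt_congr fun z hz => ?_
    have hz0 : z ≠ 0 := by rintro rfl; simp at hz
    have := awWeightZ_mul_pow hq ha hz b c d 1
    rw [pow_one] at this
    rw [this]
    simp only [qPoch, Finset.prod_range_one, pow_zero, mul_one]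
    have hzz : z * z⁻¹ = 1 := mul_inv_cancel₀ hz0
    linear_combination ((1 - a * b * c * d) * awWeightZ z a b c d q * a ^ 2) * hzz
  rw [h2, circInt_add, circInt_const_mul (-a), h, mul_zero, add_zero]
  · exact fun z hz => continuousAt_const.mul (hw z hz)
  · intro z hz
    have hz0 : z ≠ 0 := by rintro rfl; simp at hz
    exact continuousAt_const.mul ((hw z hz).mul (by fun_prop (disch := assumption)))

theorem awCircInt_shift_pow {q : ℝ} (hq0 : 0 < q) (hq1 : q < 1) {a b c d : ℂ} (ha : ‖a‖ < 1)
    (hb : ‖b‖ < 1) (hc : ‖c‖ < 1) (hd : ‖d‖ < 1) (n : ℕ) :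
    qPoch (a * b * c * d) q n * awCircInt (a * q ^ n) b c d q =
      qPoch (a * b) q n * qPoch (a * c) q n * qPoch (a * d) q n * awCircInt a b c d q := by
  have hq : ‖(q : ℂ)‖ < 1 := by simpa [abs_of_pos hq0] using hq1
  induction n with
  | zero => simp
  | succ n ih =>
    have h := awCircInt_shift hq0 hq1 (norm_mul_pow_lt_one hq ha n) hb hc hd
    rw [qPoch_succ, qPoch_succ, qPoch_succ, qPoch_succ, pow_succ, ← mul_assoc a]
    linear_combination qPoch (a * b * c * d) q n * h +
      (1 - a * b * q ^ n) * (1 - a * c * q ^ n) * (1 - a * d * q ^ n) * ih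

theorem awCircInt_tendsto {q : ℝ} (hq0 : 0 < q) (hq1 : q < 1) {a b c d : ℂ} (ha : ‖a‖ < 1)
    (hb : ‖b‖ < 1) (hc : ‖c‖ < 1) (hd : ‖d‖ < 1) :
    Tendsto (fun n : ℕ => awCircInt (a * q ^ n) b c d q) atTop (𝓝 (awCircInt 0 b c d q)) := by
  have hq : ‖(q : ℂ)‖ < 1 := by simpa [abs_of_pos hq0] using hq1
  have hp := continuous_qPochInf hq
  -- Clamping keeps `|a · clamp t| < 1` for every real `t`, so the integrand is jointly continuous
  -- on all of `ℝ × ℝ`; the limit is then taken along `t = q^n`.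
  set clamp : ℝ → ℝ := fun t => max 0 (min t 1) with hclamp
  have hcl : Continuous clamp := by fun_prop
  have hcl1 : ∀ t, ‖a * (clamp t : ℂ)‖ < 1 := fun t => norm_mul_lt_one ha (by
    rw [Complex.norm_real, Real.norm_of_nonneg (le_max_left _ _)]
    exact max_le zero_le_one (min_le_right _ _))
  have hcont : Continuous fun t : ℝ => awCircInt (a * clamp t) b c d q := by
    unfold awCircInt circInt
    refine intervalIntegral.continuous_parametric_intervalIntegral_of_continuous' ?_ _ _
    have hinv : ∀ θ : ℝ, (circleMap 0 1 θ)⁻¹ = circleMap 0 1 (-θ) := fun θ => by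
      simp [circleMap, Complex.exp_neg]
    have hc0 := continuous_circleMap 0 1
    unfold Function.uncurry awWeightZ
    simp only [hinv]
    refine Continuous.div ?_ ?_ ?_
    · exact (hp.comp (f := fun p : ℝ × ℝ => circleMap 0 1 p.2 ^ 2) (by fun_prop)).mul
        (hp.comp (f := fun p : ℝ × ℝ => circleMap 0 1 (-p.2) ^ 2) (by fun_prop))
    · have h1 : ∀ s, Continuous fun p : ℝ × ℝ => qPochInf (s * circleMap 0 1 p.2) q := fun s =>
        hp.comp (f := fun p : ℝ × ℝ => s * circleMap 0 1 p.2) (by fun_prop)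
      have h2 : ∀ s, Continuous fun p : ℝ × ℝ => qPochInf (s * circleMap 0 1 (-p.2)) q := fun s =>
        hp.comp (f := fun p : ℝ × ℝ => s * circleMap 0 1 (-p.2)) (by fun_prop)
      have h3 : Continuous fun p : ℝ × ℝ =>
          qPochInf (a * (clamp p.1 : ℂ) * circleMap 0 1 p.2) q :=
        hp.comp (f := fun p : ℝ × ℝ => a * (clamp p.1 : ℂ) * circleMap 0 1 p.2) (by fun_prop)
      have h4 : Continuous fun p : ℝ × ℝ =>
          qPochInf (a * (clamp p.1 : ℂ) * circleMap 0 1 (-p.2)) q :=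
        hp.comp (f := fun p : ℝ × ℝ => a * (clamp p.1 : ℂ) * circleMap 0 1 (-p.2)) (by fun_prop)
      exact ((((((h3.mul h4).mul (h1 b)).mul (h2 b)).mul (h1 c)).mul (h2 c)).mul (h1 d)).mul (h2 d)
    · rintro ⟨t, θ⟩
      have e : ∀ s φ, ‖s‖ < 1 → qPochInf (s * circleMap 0 1 φ) q ≠ 0 := fun s φ hs =>
        qPochInf_ne_zero hq (norm_mul_lt_one hs (norm_circleMap_one φ).le)
      simp only [ne_eq, mul_eq_zero, e _ _ (hcl1 t), e _ _ hb, e _ _ hc, e _ _ hd, or_self,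
        not_false_eq_true]
  have hlim := (hcont.tendsto 0).comp (tendsto_pow_atTop_nhds_zero_of_lt_one hq0.le hq1)
  have h0 : clamp 0 = 0 := by simp [hclamp]
  have hpow : ∀ n : ℕ, clamp (q ^ n) = q ^ n := fun n => by
    rw [hclamp]
    simp only
    rw [min_eq_left (pow_le_one₀ hq0.le hq1.le), max_eq_right (by positivity)]
  simp only [h0, Complex.ofReal_zero, mul_zero] at hlim
  refine hlim.congr fun n => ?_
  simp [hpow]

theorem awCircInt_reduce {q : ℝ} (hq0 : 0 < q) (hq1 : q < 1) {a b c d : ℂ} (ha : ‖a‖ < 1)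
    (hb : ‖b‖ < 1) (hc : ‖c‖ < 1) (hd : ‖d‖ < 1) :
    qPochInf (a * b * c * d) q * awCircInt 0 b c d q =
      qPochInf (a * b) q * qPochInf (a * c) q * qPochInf (a * d) q * awCircInt a b c d q := by
  have hq : ‖(q : ℂ)‖ < 1 := by simpa [abs_of_pos hq0] using hq1
  have h1 := (qPochInf_tendsto (a * b * c * d) q hq).mul (awCircInt_tendsto hq0 hq1 ha hb hc hd)
  have h2 := (((qPochInf_tendsto (a * b) q hq).mul (qPochInf_tendsto (a * c) q hq)).mul
    (qPochInf_tendsto (a * d) q hq)).mul_const (awCircInt a b c d q)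
  exact tendsto_nhds_unique h1 (h2.congr fun n =>
    (awCircInt_shift_pow hq0 hq1 ha hb hc hd n).symm)

/-- The parameters are sent to 0 one at a time; once one of them is 0, the factor on the left of
`awCircInt_reduce` is `(0;q)_∞ = 1`. -/
theorem awCircInt_eq_zero_params {q : ℝ} (hq0 : 0 < q) (hq1 : q < 1) {a b c d : ℂ} (ha : ‖a‖ < 1)
    (hb : ‖b‖ < 1) (hc : ‖c‖ < 1) (hd : ‖d‖ < 1) :
    qPochInf (a * b * c * d) q * awCircInt 0 0 0 0 q =
      qPochInf (a * b) q * qPochInf (a * c) q * qPochInf (a * d) q * qPochInf (b * c) q *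
        qPochInf (b * d) q * qPochInf (c * d) q * awCircInt a b c d q := by
  have h0 : ‖(0 : ℂ)‖ < 1 := by simp
  have e1 := awCircInt_reduce hq0 hq1 ha hb hc hd
  have e2 := awCircInt_reduce hq0 hq1 hb h0 hc hd
  have e3 := awCircInt_reduce hq0 hq1 hc h0 h0 hd
  have s1 : awCircInt b 0 c d q = awCircInt 0 b c d q := by
    unfold awCircInt; congr 1; ext z; exact awWeightZ_swap_ab ..
  have s2 : awCircInt c 0 0 d q = awCircInt 0 0 c d q := by
    unfold awCircInt; congr 1; ext z; exact awWeightZ_swap_ac ..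
  have s3 : awCircInt d 0 0 0 q = awCircInt 0 0 0 d q := by
    unfold awCircInt; congr 1; ext z; rw [awWeightZ_swap_cd, awWeightZ_swap_ac, awWeightZ_swap_cd]
  have e4 := awCircInt_reduce hq0 hq1 hd h0 h0 h0
  rw [s1] at e2
  rw [s2] at e3
  rw [s3] at e4
  simp only [mul_zero, zero_mul, qPochInf_zero, one_mul, mul_one] at e2 e3 e4
  rw [e4, e3, e2]
  linear_combination qPochInf (b * c) q * qPochInf (b * d) q * qPochInf (c * d) q * e1

/-- Splitting `(qu²;q)_∞` into even and odd factors and taking square roots gives `(±qu, ±ru;q)_∞`,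
so the denominator cancels all of the numerator but `(1 - z²)(1 - z⁻²)`. -/
theorem awWeightZ_special {q r z : ℂ} (hq : ‖q‖ < 1) (hr : r ^ 2 = q) (hr1 : ‖r‖ < 1)
    (hz : ‖z‖ = 1) : awWeightZ z q (-q) r (-r) q = 2 - (z ^ 2 + z⁻¹ ^ 2) := by
  have hz0 : z ≠ 0 := by rintro rfl; simp at hz
  have hzi : ‖z⁻¹‖ = 1 := by simp [hz]
  have hq2 := norm_sq_lt_one hq
  have key : ∀ u, qPochInf (u ^ 2) q = (1 - u ^ 2) * (qPochInf (q * u) q * qPochInf (-q * u) q *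
      (qPochInf (r * u) q * qPochInf (-r * u) q)) := by
    intro u
    rw [qPochInf_eq_one_sub_mul _ hq, qPochInf_even_mul_odd _ hq, neg_mul, neg_mul,
      ← qPochInf_sq _ hq, ← qPochInf_sq _ hq, mul_pow, mul_pow, hr]
    ring_nf
  have n : ∀ u s, ‖u‖ = 1 → ‖s‖ < 1 → qPochInf (s * u) q ≠ 0 := fun u s hu hs =>
    qPochInf_ne_zero hq (norm_mul_lt_one hs hu.le)
  have hq' : ‖-q‖ < 1 := by rwa [norm_neg]
  have hr' : ‖-r‖ < 1 := by rwa [norm_neg]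
  unfold awWeightZ
  rw [key z, key z⁻¹, div_eq_iff (by
    simp only [ne_eq, mul_eq_zero, n _ _ hz hq, n _ _ hz hq', n _ _ hz hr1, n _ _ hz hr',
      n _ _ hzi hq, n _ _ hzi hq', n _ _ hzi hr1, n _ _ hzi hr', or_self, not_false_eq_true])]
  have h : (1 - z ^ 2) * (1 - z⁻¹ ^ 2) = 2 - (z ^ 2 + z⁻¹ ^ 2) := by field_simp; ring
  rw [← h]
  ring

theorem circInt_two_sub : circInt (fun z => 2 - (z ^ 2 + z⁻¹ ^ 2)) = 4 * Real.pi := by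
  have h : ∀ θ : ℝ, (2 - (circleMap 0 1 θ ^ 2 + (circleMap 0 1 θ)⁻¹ ^ 2) : ℂ) =
      ((2 - 2 * Real.cos (2 * θ) : ℝ) : ℂ) := by
    intro θ
    push_cast
    rw [Complex.cos]
    simp only [circleMap, ← Complex.exp_nat_mul, ← Complex.exp_neg, zero_add, Complex.ofReal_one,
      one_mul]
    push_cast
    ring_nf
  unfold circInt
  simp only [h]
  rw [intervalIntegral.integral_ofReal, intervalIntegral.integral_sub (by simp)
    (Continuous.intervalIntegrable (by fun_prop) _ _), intervalIntegral.integral_const_mul,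
    intervalIntegral.integral_comp_mul_left _ two_ne_zero]
  have : Real.sin (2 * (2 * Real.pi)) = 0 := by
    have := Real.sin_nat_mul_pi 4
    rw [← this]; congr 1; push_cast; ring
  simp [this]
  ring

theorem awCircInt_zero {q : ℝ} (hq0 : 0 < q) (hq1 : q < 1) :
    qPochInf q q * awCircInt 0 0 0 0 q = 4 * Real.pi := by
  have hq : ‖(q : ℂ)‖ < 1 := by simpa [abs_of_pos hq0] using hq1
  have hq2 := norm_sq_lt_one hq
  set r : ℂ := ((Real.sqrt q : ℝ) : ℂ) with hrdef
  have hr : r ^ 2 = q := by rw [hrdef]; exact_mod_cast Real.sq_sqrt hq0.le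
  have hr1 : ‖r‖ < 1 := by
    rw [hrdef, Complex.norm_real, Real.norm_of_nonneg (Real.sqrt_nonneg _)]
    rw [Real.sqrt_lt' one_pos]; simpa
  have hq' : ‖-(q : ℂ)‖ < 1 := by rwa [norm_neg]
  have hr' : ‖-r‖ < 1 := by rwa [norm_neg]
  have h := awCircInt_eq_zero_params hq0 hq1 hq hq' hr1 hr'
  have hJ : awCircInt q (-q) r (-r) q = 4 * Real.pi := by
    unfold awCircInt
    rw [circInt_congr fun z hz => awWeightZ_special hq hr hr1 hz, circInt_two_sub]
  rw [hJ] at h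
  set P := qPochInf (q : ℂ) q with hP
  set M := qPochInf (-(q : ℂ)) q with hM
  set H := qPochInf r q * qPochInf (-r) q with hH
  -- Euler's identity `(-q;q)_∞ (q;q²)_∞ = 1`; the products at the special parameters collapse to a
  -- power of it.
  have euler : M * H = 1 := by
    have h1 : H = qPochInf q ((q : ℂ) ^ 2) := by rw [hH, ← qPochInf_sq _ hq, hr]
    have h2 : P * M = qPochInf ((q : ℂ) ^ 2) ((q : ℂ) ^ 2) := (qPochInf_sq _ hq).symm
    have h3 : P = H * (P * M) := by
      rw [h1, h2, hP, qPochInf_even_mul_odd _ hq, sq]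
    have hP0 : P ≠ 0 := qPochInf_ne_zero hq hq
    apply mul_left_cancel₀ hP0
    linear_combination -h3
  have k1 : M = (1 + q) * qPochInf (q * -q) q := by
    rw [hM, qPochInf_eq_one_sub_mul _ hq]; ring_nf
  have k2 : H = (1 - q) * (qPochInf (q * r) q * qPochInf (q * -r) q) := by
    rw [hH, qPochInf_eq_one_sub_mul _ hq, qPochInf_eq_one_sub_mul (-r) hq, ← hr]; ring_nf
  have k3 : P = (1 - q) * (1 - q ^ 2) * qPochInf (q * -q * r * -r) q := by
    rw [hP, qPochInf_eq_one_sub_mul _ hq, qPochInf_eq_one_sub_mul _ hq, ← hr]; ring_nf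
  have c1 : (-q : ℂ) * r = q * -r := by ring
  have c2 : (-q : ℂ) * -r = q * r := by ring
  have c3 : r * -r = -(q : ℂ) := by rw [← hr]; ring
  rw [c1, c2, c3, ← hM] at h
  set X := qPochInf (q * -q : ℂ) q
  set Y := qPochInf (q * r : ℂ) q * qPochInf (q * -r) q with hY
  set Z := qPochInf (q * -q * r * -r : ℂ) q
  set J := awCircInt 0 0 0 0 q
  have hh : Z * J = X * Y ^ 2 * M * (4 * Real.pi) := by rw [h, hY]; ring
  have e2 : (1 - (q : ℂ)) * (1 - q ^ 2) * (X * Y ^ 2 * M) = 1 := by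
    have : (1 - (q : ℂ)) * (1 - q ^ 2) * (X * Y ^ 2 * M) =
        ((1 + q) * X) * M * ((1 - q) * Y) ^ 2 := by ring
    rw [this, ← k1, ← k2, ← one_pow (M := ℂ) 2, ← euler]
    ring
  calc P * J = (1 - (q : ℂ)) * (1 - q ^ 2) * (Z * J) := by rw [k3]; ring
    _ = _ := by rw [hh]; linear_combination (4 * Real.pi : ℂ) * e2

/-- The Askey--Wilson integral. -/
theorem awCircInt_eq {q : ℝ} (hq0 : 0 < q) (hq1 : q < 1) {a b c d : ℂ} (ha : ‖a‖ < 1)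
    (hb : ‖b‖ < 1) (hc : ‖c‖ < 1) (hd : ‖d‖ < 1) :
    awCircInt a b c d q = 4 * Real.pi * qPochInf (a * b * c * d) q /
      (qPochInf q q * qPochInf (a * b) q * qPochInf (a * c) q * qPochInf (a * d) q *
        qPochInf (b * c) q * qPochInf (b * d) q * qPochInf (c * d) q) := by
  have hq : ‖(q : ℂ)‖ < 1 := by simpa [abs_of_pos hq0] using hq1
  have n : ∀ s t : ℂ, ‖s‖ < 1 → ‖t‖ < 1 → qPochInf (s * t) q ≠ 0 := fun s t hs ht =>
    qPochInf_ne_zero hq (norm_mul_lt_one hs ht.le)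
  rw [eq_div_iff (by
    simp only [ne_eq, mul_eq_zero, n _ _ ha hb, n _ _ ha hc, n _ _ ha hd, n _ _ hb hc, n _ _ hb hd,
      n _ _ hc hd, qPochInf_ne_zero hq hq, or_self, not_false_eq_true])]
  linear_combination (qPochInf (a * b * c * d) q) * awCircInt_zero hq0 hq1 -
    qPochInf q q * awCircInt_eq_zero_params hq0 hq1 ha hb hc hd

/-! ### The substitution `x = cos θ`. -/

theorem circInt_eq_two_mul {φ : ℂ → ℂ} (hφ : ∀ z, ‖z‖ = 1 → ContinuousAt φ z)
    (hinv : ∀ z, φ z⁻¹ = φ z) :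
    circInt φ = 2 * ∫ θ in (0 : ℝ)..Real.pi, φ (circleMap 0 1 θ) := by
  have hc := continuous_comp_circleMap hφ
  unfold circInt
  rw [← intervalIntegral.integral_add_adjacent_intervals (b := Real.pi)
    (hc.intervalIntegrable _ _) (hc.intervalIntegrable _ _), two_mul (intervalIntegral _ _ _ _)]
  congr 1
  have h := intervalIntegral.integral_comp_sub_left (a := Real.pi) (b := 2 * Real.pi)
    (fun θ : ℝ => φ (circleMap 0 1 θ)) (2 * Real.pi)
  rw [sub_self, show 2 * Real.pi - Real.pi = Real.pi by ring] at h
  rw [← h]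
  refine intervalIntegral.integral_congr fun θ _ => ?_
  rw [← hinv]
  congr 1
  simp [circleMap, sub_mul, Complex.exp_sub]

/-- The branch chosen by `zOf` is `e^{iθ}` or `e^{-iθ}`, and the invariance of `φ` makes the choice
irrelevant. -/
theorem apply_zOf {φ : ℂ → ℂ} (hinv : ∀ z, φ z⁻¹ = φ z) {x : ℝ} (hx : x ∈ Set.Icc (-1 : ℝ) 1) :
    φ (zOf x) = φ (circleMap 0 1 (Real.arccos x)) := by
  have hz : circleMap 0 1 (Real.arccos x) ≠ 0 := circleMap_ne_center one_ne_zero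
  have h1 : (circleMap 0 1 (Real.arccos x) + (circleMap 0 1 (Real.arccos x))⁻¹) / 2 = (x : ℂ) := by
    nth_rw 3 [← Real.cos_arccos hx.1 hx.2]
    rw [Complex.ofReal_cos, Complex.cos]
    simp [circleMap, Complex.exp_neg]
  have h2 := zOf_eq _ hz
  rw [h1] at h2
  rcases h2 with h | h <;> rw [h]
  exact hinv _

/-- Substitution along the monotone function `arccos` transfers integrability from the continuous
function of `θ`, so the endpoint singularities need no separate estimate. -/
theorem intervalIntegrable_and_integral_zOf {φ : ℂ → ℂ} (hφ : ∀ z, ‖z‖ = 1 → ContinuousAt φ z)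
    (hinv : ∀ z, φ z⁻¹ = φ z) :
    IntervalIntegrable (fun x : ℝ => φ (zOf x) / (Real.sqrt (1 - x ^ 2) : ℂ))
      MeasureTheory.volume (-1) 1 ∧
    ∫ x in (-1 : ℝ)..1, φ (zOf x) / (Real.sqrt (1 - x ^ 2) : ℂ) = circInt φ / 2 := by
  have hc := continuous_comp_circleMap hφ
  set g : ℝ → ℂ := fun θ => φ (circleMap 0 1 θ) with hg
  have hder : ∀ x ∈ Set.Ioo (min (-1 : ℝ) 1) (max (-1 : ℝ) 1),
      HasDerivAt Real.arccos (-(1 / Real.sqrt (1 - x ^ 2))) x := by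
    intro x hx
    rw [min_eq_left (by norm_num), max_eq_right (by norm_num)] at hx
    exact Real.hasDerivAt_arccos hx.1.ne' hx.2.ne
  have hneg : ∀ x ∈ Set.Ioo (min (-1 : ℝ) 1) (max (-1 : ℝ) 1),
      -(1 / Real.sqrt (1 - x ^ 2)) ≤ 0 := fun x _ => by
    have : 0 ≤ 1 / Real.sqrt (1 - x ^ 2) := by positivity
    linarith
  have hcont := Real.continuous_arccos.continuousOn (s := Set.uIcc (-1 : ℝ) 1)
  have h1 := (intervalIntegral.integrable_deriv_smul_comp_iff_of_deriv_nonpos (g := g)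
    hcont hder hneg).2 (hc.intervalIntegrable _ _)
  have h2 := intervalIntegral.integral_deriv_smul_comp_of_deriv_nonpos (g := g) hcont hder hneg
  have heq : ∀ x ∈ Set.Icc (-1 : ℝ) 1, -((-(1 / Real.sqrt (1 - x ^ 2))) • (g ∘ Real.arccos) x) =
      φ (zOf x) / (Real.sqrt (1 - x ^ 2) : ℂ) := by
    intro x hx
    rw [apply_zOf hinv hx, neg_smul, neg_neg, Complex.real_smul]
    simp [hg, div_eq_inv_mul]
  constructor
  · refine h1.neg.congr fun x hx => ?_
    rw [Set.uIoc_of_le (by norm_num)] at hx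
    exact heq x ⟨hx.1.le, hx.2⟩
  -- The minus sign from the decreasing `arccos` is absorbed by reversing the integral from `π` to
  -- `0`.
  · rw [circInt_eq_two_mul hφ hinv, mul_div_cancel_left₀ _ two_ne_zero,
      ← intervalIntegral.integral_congr (f := fun x =>
        -((-(1 / Real.sqrt (1 - x ^ 2))) • (g ∘ Real.arccos) x)), intervalIntegral.integral_neg, h2,
      Real.arccos_one, Real.arccos_neg_one, ← intervalIntegral.integral_symm]
    intro x hx
    rw [Set.uIcc_of_le (by norm_num)] at hx
    exact heq x hx

/-! ### The integral as a double sum of Askey–Wilson integrals. -/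

theorem askeyWilsonZ_continuousAt (n : ℕ) (a b c d q : ℂ) {z : ℂ} (hz : z ≠ 0) :
    ContinuousAt (fun z => askeyWilsonZ n z a b c d q) z := by
  unfold askeyWilsonZ qPoch
  fun_prop (disch := assumption)

theorem askeyWilsonZ_perm (n : ℕ) (z a b c d q : ℂ) :
    askeyWilsonZ n z a b c d q = askeyWilsonZ n z a b d c q := by
  unfold askeyWilsonZ
  rw [mul_right_comm (_ * a * b) c d]
  congr 1
  refine Finset.sum_congr rfl fun j _ => ?_
  ring

/-- The integrand of `awIntegral` as a function of `z`, without the factor `1 / √(1 - x²)`. -/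
def awProdZ (n k : ℕ) (a b c d e f q z : ℂ) : ℂ :=
  askeyWilsonZ n z a b c d q * askeyWilsonZ k z a b e f q * awWeightZ z a b c f q

theorem awProdZ_inv (n k : ℕ) (a b c d e f q z : ℂ) :
    awProdZ n k a b c d e f q z⁻¹ = awProdZ n k a b c d e f q z := by
  unfold awProdZ
  rw [askeyWilsonZ_inv, askeyWilsonZ_inv, awWeightZ_inv]

theorem awProdZ_continuousAt {n k : ℕ} {a b c d e f q z : ℂ} (hq : ‖q‖ < 1) (ha : ‖a‖ < 1)
    (hb : ‖b‖ < 1) (hc : ‖c‖ < 1) (hf : ‖f‖ < 1) (hz : ‖z‖ = 1) :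
    ContinuousAt (awProdZ n k a b c d e f q) z := by
  have hz0 : z ≠ 0 := by rintro rfl; simp at hz
  exact ((askeyWilsonZ_continuousAt n a b c d q hz0).mul
    (askeyWilsonZ_continuousAt k a b e f q hz0)).mul (awWeightZ_continuousAt hq ha hb hc hf hz)

theorem awIntegrand_intervalIntegrable (n k : ℕ) {q a b c f : ℂ} (hq : ‖q‖ < 1) (d e : ℂ)
    (ha : ‖a‖ < 1) (hb : ‖b‖ < 1) (hc : ‖c‖ < 1) (hf : ‖f‖ < 1) :
    IntervalIntegrable (awIntegrand n k a b c d e f q) MeasureTheory.volume (-1) 1 :=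
  (intervalIntegrable_and_integral_zOf (φ := awProdZ n k a b c d e f q)
    (fun _ hz => awProdZ_continuousAt hq ha hb hc hf hz) (awProdZ_inv n k a b c d e f q)).1

theorem awIntegral_eq_circInt (n k : ℕ) {q a b c f : ℂ} (hq : ‖q‖ < 1) (d e : ℂ)
    (ha : ‖a‖ < 1) (hb : ‖b‖ < 1) (hc : ‖c‖ < 1) (hf : ‖f‖ < 1) :
    awIntegral n k a b c d e f q = circInt (awProdZ n k a b c d e f q) / 2 :=
  (intervalIntegrable_and_integral_zOf (φ := awProdZ n k a b c d e f q)
    (fun _ hz => awProdZ_continuousAt hq ha hb hc hf hz) (awProdZ_inv n k a b c d e f q)).2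

theorem awIntegral_symm (n k : ℕ) (a b c d e f q : ℂ) :
    awIntegral n k a b c d e f q = awIntegral k n a b f e d c q := by
  unfold awIntegral awIntegrand
  congr 1 with x
  unfold askeyWilson awWeight
  rw [askeyWilsonZ_perm n, askeyWilsonZ_perm k, awWeightZ_swap_cd]
  ring

/-- The coefficients of `askeyWilsonZ n z a b c d q` in the basis `(a z, a / z; q)_j`. -/
def awCoeff (n : ℕ) (a b c d q : ℂ) (j : ℕ) : ℂ :=
  qPoch (q ^ (-(n : ℤ))) q j * qPoch (q ^ ((n : ℤ) - 1) * a * b * c * d) q j / qPoch q q j *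
    (qPoch (a * b * q ^ j) q (n - j) * qPoch (a * c * q ^ j) q (n - j) *
      qPoch (a * d * q ^ j) q (n - j)) * q ^ j

theorem askeyWilsonZ_eq_sum_coeff (n : ℕ) (z a b c d q : ℂ) :
    askeyWilsonZ n z a b c d q = a ^ (-(n : ℤ)) * ∑ j ∈ Finset.range (n + 1),
      awCoeff n a b c d q j * (qPoch (a * z) q j * qPoch (a * z⁻¹) q j) := by
  unfold askeyWilsonZ awCoeff
  congr 1
  refine Finset.sum_congr rfl fun j _ => ?_
  ring

/-- The two polynomials are rewritten with base parameters `c` and `f`, the parameters of the weight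
not shared by both; the weight then absorbs each basis element as a shift of its own parameter. -/
theorem circInt_awProdZ {q : ℂ} (hq0 : q ≠ 0) (hq : ‖q‖ < 1) (n k : ℕ) {a b c d e f : ℂ}
    (ha : a ≠ 0) (hc : c ≠ 0) (hd : d ≠ 0) (he : e ≠ 0) (hf : f ≠ 0)
    (ha1 : ‖a‖ < 1) (hb1 : ‖b‖ < 1) (hc1 : ‖c‖ < 1) (hf1 : ‖f‖ < 1) :
    circInt (awProdZ n k a b c d e f q) = c ^ (-(n : ℤ)) * f ^ (-(k : ℤ)) *
      ∑ j ∈ Finset.range (n + 1), ∑ i ∈ Finset.range (k + 1),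
        awCoeff n c b a d q j * awCoeff k f b a e q i *
          awCircInt a b (c * q ^ j) (f * q ^ i) q := by
  have hc' := norm_mul_pow_lt_one hq hc1
  have hf' := norm_mul_pow_lt_one hq hf1
  have hcont : ∀ j i, ∀ z : ℂ, ‖z‖ = 1 → ContinuousAt (fun z =>
      awCoeff n c b a d q j * awCoeff k f b a e q i *
        awWeightZ z a b (c * q ^ j) (f * q ^ i) q) z := fun j i z hz =>
    continuousAt_const.mul (awWeightZ_continuousAt hq ha1 hb1 (hc' j) (hf' i) hz)
  unfold awCircInt
  simp only [← circInt_const_mul]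
  have h1 : ∀ j, ∑ i ∈ Finset.range (k + 1), circInt (fun z =>
      awCoeff n c b a d q j * awCoeff k f b a e q i *
        awWeightZ z a b (c * q ^ j) (f * q ^ i) q) =
      circInt fun z => ∑ i ∈ Finset.range (k + 1), awCoeff n c b a d q j * awCoeff k f b a e q i *
        awWeightZ z a b (c * q ^ j) (f * q ^ i) q := fun j =>
    (circInt_sum _ fun i _ => hcont j i).symm
  simp only [h1]
  rw [← circInt_sum _ fun j _ z hz => tendsto_finsetSum _ fun i _ => hcont j i z hz,
    ← circInt_const_mul]
  refine circInt_congr fun z hz => ?_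
  have hz0 : z ≠ 0 := by rintro rfl; simp at hz
  have hw : ∀ j i, awWeightZ z a b (c * q ^ j) (f * q ^ i) q = awWeightZ z a b c f q *
      (qPoch (c * z) q j * qPoch (c * z⁻¹) q j) * (qPoch (f * z) q i * qPoch (f * z⁻¹) q i) := by
    intro j i
    rw [awWeightZ_swap_ac, awWeightZ_mul_pow hq hc1 hz, awWeightZ_swap_cd, awWeightZ_swap_ac,
      awWeightZ_mul_pow hq hf1 hz, awWeightZ_swap_ac, awWeightZ_swap_cd, awWeightZ_swap_ac]
    ring
  unfold awProdZ
  rw [askeyWilsonZ_swap hq0 hq n b hz0 ha hc hd, askeyWilsonZ_perm k,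
    askeyWilsonZ_swap hq0 hq k b hz0 ha hf he, askeyWilsonZ_eq_sum_coeff,
    askeyWilsonZ_eq_sum_coeff]
  simp only [hw]
  rw [mul_mul_mul_comm, Finset.sum_mul_sum, mul_assoc, Finset.sum_mul]
  congr 1
  refine Finset.sum_congr rfl fun j _ => ?_
  rw [Finset.sum_mul]
  refine Finset.sum_congr rfl fun i _ => ?_
  ring

/-! ### Summing the inner sum and recognising the `₄φ₃`. -/

theorem qPochInf_mul_pow (x : ℂ) {q : ℂ} (hq : ‖q‖ < 1) {j n : ℕ} (h : j ≤ n) :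
    qPochInf (x * q ^ j) q = qPoch (x * q ^ j) q (n - j) * qPochInf (x * q ^ n) q := by
  rw [qPochInf_eq_qPoch_mul _ hq (n - j), mul_assoc, ← pow_add, Nat.add_sub_cancel' h]

/-- With `y = e/c` this moves the `j`-dependence of `(e/(cq^j);q)_k` into factorials of length `j`;
it is the source of the parameters `qc/e` and `q^{1-k}c/e`. -/
theorem qPoch_div_pow {q y : ℂ} (hq0 : q ≠ 0) (hy : y ≠ 0) (k j : ℕ) :
    qPoch (y / q ^ j) q k * qPoch (q ^ (1 - (k : ℤ)) * y⁻¹) q j * (q ^ j) ^ k =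
      qPoch y q k * qPoch (q / y) q j := by
  induction j with
  | zero => simp
  | succ j ih =>
    have hqj : q ^ j ≠ 0 := pow_ne_zero _ hq0
    have hqk : q ^ k ≠ 0 := pow_ne_zero _ hq0
    obtain ⟨X, hX⟩ : ∃ X, X = q ^ (1 - (k : ℤ)) * y⁻¹ := ⟨_, rfl⟩
    have hX' : X * y * q ^ k = q := by
      rw [hX, zpow_sub₀ hq0, zpow_one, zpow_natCast]
      field_simp
    obtain ⟨u, hu⟩ : ∃ u, u = y / q ^ (j + 1) := ⟨_, rfl⟩
    have hu1 : u * q ^ j * q = y := by rw [hu, pow_succ]; field_simp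
    have hu2 : y / q ^ j = u * q := by rw [hu, pow_succ]; field_simp
    have hstep : qPoch u q k * (1 - u * q ^ k) = (1 - u) * qPoch (u * q) q k := by
      rw [← qPoch_succ, qPoch_succ']
    have hXu : X * q ^ j * (u * q ^ k) = 1 := by
      apply mul_right_cancel₀ hq0
      linear_combination X * q ^ k * hu1 + hX'
    have hyq : q / y * q ^ j * u = 1 := by
      field_simp
      linear_combination hu1
    rw [← hX] at ih ⊢
    rw [← hu, qPoch_succ, qPoch_succ, pow_succ, mul_pow, ← mul_assoc (qPoch y q k), ← ih, hu2]
    have h1 : qPoch u q k * (1 - X * q ^ j) * q ^ k =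
        qPoch (u * q) q k * (1 - q / y * q ^ j) := by
      have e1 : X * q ^ j * q ^ k = q / y * q ^ j := by
        have : q / y = X * q ^ k := by rw [div_eq_iff hy]; linear_combination -hX'
        rw [this]; ring
      linear_combination (-X * q ^ j * q ^ k) * hstep - qPoch u q k * q ^ k * hXu -
        (1 - u) * qPoch (u * q) q k * e1 + qPoch (u * q) q k * hyq
    have : (q ^ k) ^ j = (q ^ j) ^ k := by rw [← pow_mul, ← pow_mul, mul_comm]
    linear_combination qPoch X q j * (q ^ j) ^ k * h1

/-- After insertion of the evaluated integrals, the factors with `af` and `bf` in the coefficients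
combine with the infinite products into ones free of `i`. What remains is Saalschütz with numerator
parameters `cf`, `q^{k-1}abef` and denominator parameters `ef`, `abcf`. -/
theorem sum_awCoeff_mul_awCircInt {q : ℝ} (hq0 : 0 < q) (hq1 : q < 1) (k : ℕ) {a b c e f : ℂ}
    (ha : a ≠ 0) (hb : b ≠ 0) (hc : c ≠ 0) (hf : f ≠ 0)
    (ha1 : ‖a‖ < 1) (hb1 : ‖b‖ < 1) (hc1 : ‖c‖ < 1) (hf1 : ‖f‖ < 1) :
    ∑ i ∈ Finset.range (k + 1), awCoeff k f b a e q i * awCircInt a b c (f * q ^ i) q =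
      4 * Real.pi * qPochInf (a * b * c * f * q ^ k) q * (c * f) ^ k * qPoch (e / c) q k /
        (qPochInf q q * qPochInf (a * b * q ^ k) q * qPochInf (a * c) q * qPochInf (b * c) q *
          qPochInf (a * f * q ^ k) q * qPochInf (b * f * q ^ k) q * qPochInf (c * f) q) := by
  have hq : ‖(q : ℂ)‖ < 1 := by simpa [abs_of_pos hq0] using hq1
  have hqc : (q : ℂ) ≠ 0 := by exact_mod_cast hq0.ne'
  have hn : ∀ s t : ℂ, ‖s‖ < 1 → ‖t‖ < 1 → qPochInf (s * t) q ≠ 0 := fun s t hs ht =>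
    qPochInf_ne_zero hq (norm_mul_lt_one hs ht.le)
  have hnn : ∀ s t : ℂ, ‖s‖ < 1 → ‖t‖ < 1 → ∀ m, qPochInf (s * t * (q : ℂ) ^ m) q ≠ 0 :=
    fun s t hs ht m => qPochInf_ne_zero hq (norm_mul_pow_lt_one hq (norm_mul_lt_one hs ht.le) m)
  have hnp : ∀ s t : ℂ, ‖s‖ < 1 → ‖t‖ < 1 → ∀ m, qPoch (s * t) q m ≠ 0 := fun s t hs ht m =>
    qPoch_ne_zero hq (norm_mul_lt_one hs ht.le) m
  have nq := qPochInf_ne_zero hq hq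
  have saal := sum_saalschutz hqc hq (A := c * f) (B := (q : ℂ) ^ ((k : ℤ) - 1) * f * b * a * e)
    (C := f * e) (D := a * b * c * f) (α := e / c) (β := a * b) k (mul_ne_zero hc hf)
    (mul_ne_zero ha hb) (by field_simp) (by ring)
    (by rw [zpow_sub_one₀ hqc, zpow_natCast]; field_simp)
  have hterm : ∀ i ∈ Finset.range (k + 1),
      awCoeff k f b a e q i * awCircInt a b c (f * q ^ i) q =
      4 * Real.pi * qPochInf (a * b * c * f * q ^ k) q /
        (qPochInf q q * qPochInf (a * b) q * qPochInf (a * c) q * qPochInf (b * c) q *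
          qPochInf (a * f * q ^ k) q * qPochInf (b * f * q ^ k) q * qPochInf (c * f) q) *
      (qPoch ((q : ℂ) ^ (-(k : ℤ))) q i / qPoch q q i * (q : ℂ) ^ i *
      (qPoch (c * f) q i * qPoch ((q : ℂ) ^ ((k : ℤ) - 1) * f * b * a * e) q i) *
      (qPoch (f * e * q ^ i) q (k - i) * qPoch (a * b * c * f * q ^ i) q (k - i))) := by
    intro i hi
    have hik := Nat.lt_succ_iff.1 (Finset.mem_range.1 hi)
    rw [awCircInt_eq hq0 hq1 ha1 hb1 hc1 (norm_mul_pow_lt_one hq hf1 i)]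
    simp only [← mul_assoc]
    have g1 := qPochInf_mul_pow (a * b * c * f) hq hik
    have g2 := qPochInf_mul_pow (a * f) hq hik
    have g3 := qPochInf_mul_pow (b * f) hq hik
    have g4 := qPochInf_eq_qPoch_mul (c * f) hq i
    have m1 := hnn a f ha1 hf1 i
    have m2 := hnn b f hb1 hf1 i
    have m3 := hn c f hc1 hf1
    unfold awCoeff
    rw [g1, g2, g3, g4, mul_comm f b, mul_comm f a]
    rw [g2] at m1
    rw [g3] at m2
    rw [g4] at m3
    have l1 := left_ne_zero_of_mul m1
    have r1 := right_ne_zero_of_mul m1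
    have l2 := left_ne_zero_of_mul m2
    have r2 := right_ne_zero_of_mul m2
    have l3 := left_ne_zero_of_mul m3
    have r3 := right_ne_zero_of_mul m3
    have n1 := hn a b ha1 hb1
    have n2 := hn a c ha1 hc1
    have n3 := hn b c hb1 hc1
    have n4 := qPoch_ne_zero hq hq i
    generalize qPoch (a * f * (q : ℂ) ^ i) q (k - i) = X1 at *
    generalize qPoch (b * f * (q : ℂ) ^ i) q (k - i) = X2 at *
    generalize qPoch (c * f) (q : ℂ) i = X3 at *
    generalize qPochInf (a * f * (q : ℂ) ^ k) q = X4 at *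
    generalize qPochInf (b * f * (q : ℂ) ^ k) q = X5 at *
    generalize qPochInf (c * f * (q : ℂ) ^ i) q = X6 at *
    generalize qPochInf (a * b) (q : ℂ) = X7 at *
    generalize qPochInf (a * c) (q : ℂ) = X8 at *
    generalize qPochInf (b * c) (q : ℂ) = X9 at *
    generalize qPoch (q : ℂ) (q : ℂ) i = X10 at *
    generalize qPochInf (q : ℂ) (q : ℂ) = X11 at *
    generalize qPochInf (a * b * c * f * (q : ℂ) ^ k) q = X12 at *
    generalize qPoch (a * b * c * f * (q : ℂ) ^ i) q (k - i) = X13 at *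
    generalize qPoch (f * e * (q : ℂ) ^ i) q (k - i) = X14 at *
    generalize qPoch ((q : ℂ) ^ (-(k : ℤ))) q i = X15 at *
    generalize qPoch ((q : ℂ) ^ ((k : ℤ) - 1) * f * b * a * e) q i = X16 at *
    generalize (q : ℂ) ^ i = Q at *
    clear saal hi g1 g2 g3 g4 hn hnn hnp
    field_simp
  rw [Finset.sum_congr rfl hterm, ← Finset.mul_sum, saal]
  have h1 := qPochInf_eq_qPoch_mul (a * b) hq k
  have l1 := hnp a b ha1 hb1 k
  have r1 := hnn a b ha1 hb1 k
  rw [h1]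
  generalize qPoch (a * b) (q : ℂ) k = X1 at *
  have : ∀ x y D1 D2 D3 D4 D5 D6 D7 : ℂ, x / (D1 * (X1 * D2) * D3 * D4 * D5 * D6 * D7) *
      ((c * f) ^ k * y * X1) =
      x * (c * f) ^ k * y / (D1 * D2 * D3 * D4 * D5 * D6 * D7) := by
    intro x y D1 D2 D3 D4 D5 D6 D7
    rw [show D1 * (X1 * D2) * D3 * D4 * D5 * D6 * D7 = X1 * (D1 * D2 * D3 * D4 * D5 * D6 * D7) by
      ring, div_mul_eq_mul_div, show x * ((c * f) ^ k * y * X1) = X1 * (x * (c * f) ^ k * y) by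
      ring, mul_div_mul_left _ _ l1]
  exact this ..

theorem phi43_eq_sum (n : ℕ) {q : ℂ} (hq : q ≠ 0) (a₂ a₃ a₄ b₁ b₂ b₃ z : ℂ) :
    phi43 (q ^ (-(n : ℤ))) a₂ a₃ a₄ b₁ b₂ b₃ q z = ∑ j ∈ Finset.range (n + 1),
      (qPoch (q ^ (-(n : ℤ))) q j * qPoch a₂ q j * qPoch a₃ q j * qPoch a₄ q j) /
        (qPoch q q j * qPoch b₁ q j * qPoch b₂ q j * qPoch b₃ q j) * z ^ j := by
  refine tsum_eq_sum fun j hj => ?_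
  have h0 : qPoch (q ^ (-(n : ℤ))) q j = 0 := by
    rw [Finset.mem_range, not_lt] at hj
    refine Finset.prod_eq_zero (Finset.mem_range.2 (Nat.lt_of_succ_le hj)) ?_
    simp [hq]
  rw [h0]
  simp

theorem circInt_awProdZ_eq_phi43 {q : ℝ} (hq0 : 0 < q) (hq1 : q < 1) (n k : ℕ) {a b c d e f : ℂ}
    (ha : a ≠ 0) (hb : b ≠ 0) (hc : c ≠ 0) (hd : d ≠ 0) (he : e ≠ 0) (hf : f ≠ 0)
    (ha1 : ‖a‖ < 1) (hb1 : ‖b‖ < 1) (hc1 : ‖c‖ < 1) (hf1 : ‖f‖ < 1)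
    (hcd : qPoch (c * d) q n ≠ 0) (hce : qPoch ((q : ℂ) ^ (1 - (k : ℤ)) * (c / e)) q n ≠ 0) :
    circInt (awProdZ n k a b c d e f q) = c ^ (-(n : ℤ)) * c ^ k *
      (4 * Real.pi * qPochInf (a * b * c * f * q ^ k) q * qPoch (c * d) q n * qPoch (e / c) q k /
        (qPochInf q q * qPochInf (a * b * q ^ k) q * qPochInf (a * c * q ^ n) q *
          qPochInf (b * c * q ^ n) q * qPochInf (a * f * q ^ k) q * qPochInf (b * f * q ^ k) q *
          qPochInf (c * f) q)) *
      phi43 ((q : ℂ) ^ (-(n : ℤ))) ((q : ℂ) ^ ((n : ℤ) - 1) * a * b * c * d) (c * f) (q * c / e)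
        (c * d) (a * b * c * f * (q : ℂ) ^ k) ((q : ℂ) ^ (1 - (k : ℤ)) * (c / e)) q q := by
  have hq : ‖(q : ℂ)‖ < 1 := by simpa [abs_of_pos hq0] using hq1
  have hqc : (q : ℂ) ≠ 0 := by exact_mod_cast hq0.ne'
  have hn : ∀ s t : ℂ, ‖s‖ < 1 → ‖t‖ < 1 → qPochInf (s * t) q ≠ 0 := fun s t hs ht =>
    qPochInf_ne_zero hq (norm_mul_lt_one hs ht.le)
  have hnn : ∀ s t : ℂ, ‖s‖ < 1 → ‖t‖ < 1 → ∀ m, qPochInf (s * t * (q : ℂ) ^ m) q ≠ 0 :=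
    fun s t hs ht m => qPochInf_ne_zero hq (norm_mul_pow_lt_one hq (norm_mul_lt_one hs ht.le) m)
  have nq := qPochInf_ne_zero hq hq
  rw [circInt_awProdZ hqc hq n k ha hc hd he hf ha1 hb1 hc1 hf1, phi43_eq_sum n hqc,
    Finset.mul_sum, Finset.mul_sum]
  refine Finset.sum_congr rfl fun j hj => ?_
  have hjn := Nat.lt_succ_iff.1 (Finset.mem_range.1 hj)
  simp only [mul_assoc (awCoeff n c b a d q j)]
  rw [← Finset.mul_sum, sum_awCoeff_mul_awCircInt hq0 hq1 k ha hb
    (mul_ne_zero hc (pow_ne_zero j hqc)) hf ha1 hb1 (norm_mul_pow_lt_one hq hc1 j) hf1]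
  have hshift := qPoch_div_pow hqc (div_ne_zero he hc) k j
  have p1 : e / (c * (q : ℂ) ^ j) = e / c / (q : ℂ) ^ j := by rw [div_div]
  have p2 : (q : ℂ) / (e / c) = q * c / e := by field_simp
  have p3 : a * b * (c * (q : ℂ) ^ j) * f * (q : ℂ) ^ k = a * b * c * f * (q : ℂ) ^ k * (q : ℂ) ^ j := by
    ring
  have p4 : c * (q : ℂ) ^ j * f = c * f * (q : ℂ) ^ j := by ring
  have p5 : (q : ℂ) ^ ((n : ℤ) - 1) * c * b * a * d = (q : ℂ) ^ ((n : ℤ) - 1) * a * b * c * d := by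
    ring
  rw [inv_div, p2] at hshift
  rw [p1, p3, p4, ← mul_assoc a c, ← mul_assoc b c, mul_pow (c * f), mul_pow c f]
  have g1 := qPochInf_mul_pow (a * c) hq hjn
  have g2 := qPochInf_mul_pow (b * c) hq hjn
  have g3 := qPochInf_eq_qPoch_mul (c * f) hq j
  have g4 := qPochInf_eq_qPoch_mul (a * b * c * f * (q : ℂ) ^ k) hq j
  have g5 := qPoch_split (c * d) (q : ℂ) hjn
  have g6 := qPoch_split ((q : ℂ) ^ (1 - (k : ℤ)) * (c / e)) (q : ℂ) hjn
  have habcf : ‖a * b * c * f * (q : ℂ) ^ k‖ < 1 := norm_mul_pow_lt_one hq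
    (norm_mul_lt_one (norm_mul_lt_one (norm_mul_lt_one ha1 hb1.le) hc1.le) hf1.le) k
  have t1 := qPoch_ne_zero hq habcf j
  have t2 := qPoch_ne_zero hq hq j
  have m1 := hnn a c ha1 hc1 j
  have m2 := hnn b c hb1 hc1 j
  have m3 := hn c f hc1 hf1
  unfold awCoeff
  rw [p5, g1, g2, g3, g4, ← g5, mul_comm c b, mul_comm c a]
  rw [g1] at m1
  rw [g2] at m2
  rw [g3] at m3
  rw [← g5] at hcd
  rw [← g6] at hce
  have l1 := left_ne_zero_of_mul m1
  have r1 := right_ne_zero_of_mul m1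
  have l2 := left_ne_zero_of_mul m2
  have r2 := right_ne_zero_of_mul m2
  have l3 := left_ne_zero_of_mul m3
  have r3 := right_ne_zero_of_mul m3
  have l4 := left_ne_zero_of_mul hcd
  have l5 := left_ne_zero_of_mul hce
  have n1 := hnn a b ha1 hb1 k
  have n2 := hnn a f ha1 hf1 k
  have n3 := hnn b f hb1 hf1 k
  have hfk : f ^ (-(k : ℤ)) * f ^ k = 1 := by
    rw [zpow_neg, zpow_natCast, inv_mul_cancel₀ (pow_ne_zero _ hf)]
  -- The power `q^{jk}` comes from the factor `(cq^j f)^k` of the inner sum and is exactly what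
  -- `qPoch_div_pow` requires.
  have hV : qPoch (e / c / (q : ℂ) ^ j) q k * ((q : ℂ) ^ j) ^ k =
      qPoch (e / c) q k * qPoch (q * c / e) q j /
        qPoch ((q : ℂ) ^ (1 - (k : ℤ)) * (c / e)) q j := by
    rw [eq_div_iff l5, ← hshift]; ring
  generalize qPoch (a * c * (q : ℂ) ^ j) q (n - j) = X1 at *
  generalize qPoch (b * c * (q : ℂ) ^ j) q (n - j) = X2 at *
  generalize qPoch (c * f) (q : ℂ) j = X3 at *
  generalize qPochInf (a * c * (q : ℂ) ^ n) q = X4 at *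
  generalize qPochInf (b * c * (q : ℂ) ^ n) q = X5 at *
  generalize qPochInf (c * f * (q : ℂ) ^ j) q = X6 at *
  generalize qPochInf (a * b * (q : ℂ) ^ k) (q : ℂ) = X7 at *
  generalize qPochInf (a * f * (q : ℂ) ^ k) (q : ℂ) = X8 at *
  generalize qPochInf (b * f * (q : ℂ) ^ k) (q : ℂ) = X9 at *
  generalize qPoch (q : ℂ) (q : ℂ) j = X10 at *
  generalize qPochInf (q : ℂ) (q : ℂ) = X11 at *
  generalize qPochInf (a * b * c * f * (q : ℂ) ^ k * (q : ℂ) ^ j) q = X12 at *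
  generalize qPoch (a * b * c * f * (q : ℂ) ^ k) q j = X13 at *
  generalize qPoch (c * d * (q : ℂ) ^ j) q (n - j) = X14 at *
  generalize qPoch (c * d) q j = X15 at *
  generalize qPoch ((q : ℂ) ^ (-(n : ℤ))) q j = X16 at *
  generalize qPoch ((q : ℂ) ^ ((n : ℤ) - 1) * a * b * c * d) q j = X17 at *
  generalize qPoch (e / c / (q : ℂ) ^ j) q k = X18 at *
  generalize qPoch (e / c) q k = X19 at *
  generalize qPoch (q * c / e) q j = X20 at *
  generalize qPoch ((q : ℂ) ^ (1 - (k : ℤ)) * (c / e)) q j = X21 at *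
  generalize (q : ℂ) ^ j = Q at *
  generalize Q ^ k = R at *
  generalize c ^ (-(n : ℤ)) = S at *
  generalize f ^ (-(k : ℤ)) = F at *
  generalize f ^ k = G at *
  generalize c ^ k = H at *
  clear hshift g1 g2 g3 g4 g5 g6 p1 p2 p3 p4 p5 hn hnn hj m1 m2 m3 hcd hce habcf
  have step : S * F * (X16 * X17 / X10 * (X2 * X1 * X14) * Q * (4 * Real.pi * X12 * (H * G * R) *
      X18 / (X11 * X7 * (X1 * X4) * (X2 * X5) * X8 * X9 * X6))) =
      S * H * (X16 * X17 / X10 * X14 * Q * (4 * Real.pi * X12 *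
      (X18 * R) / (X11 * X7 * X4 * X5 * X8 * X9 * X6))) * (F * G) := by
    -- Only `X1` and `X2` cancel here; `uv - 1 = v(u - 1) + (v - 1)`, with `u = X1·X1⁻¹` and `v =
    -- X2·X2⁻¹`, gives the coefficients.
    linear_combination (S * H * (X16 * X17 / X10 * X14 * Q * (4 * Real.pi * X12 *
      (X18 * R) / (X11 * X7 * X4 * X5 * X8 * X9 * X6))) * (F * G)) *
      (X2 * X2⁻¹ * mul_inv_cancel₀ l1 + mul_inv_cancel₀ l2)
  rw [step, hfk, hV]
  linear_combination (-(S * H * (X16 * X17 / X10 * X14 * Q * (4 * Real.pi * X12 *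
      (X19 * X20 / X21) / (X11 * X7 * X4 * X5 * X8 * X9 * X6))))) *
      (X13 * X13⁻¹ * (X15 * X15⁻¹) * mul_inv_cancel₀ l3 + X15 * X15⁻¹ * mul_inv_cancel₀ t1 +
        mul_inv_cancel₀ l4)

theorem phi43_eq_awIntegral (n k : ℕ) {q : ℝ} (hq0 : 0 < q) (hq1 : q < 1) {a b c d e f : ℂ}
    (ha : a ≠ 0) (hb : b ≠ 0) (hc : c ≠ 0) (hd : d ≠ 0) (he : e ≠ 0) (hf : f ≠ 0)
    (ha1 : ‖a‖ < 1) (hb1 : ‖b‖ < 1) (hc1 : ‖c‖ < 1) (hf1 : ‖f‖ < 1)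
    (hcd : qPoch (c * d) q n ≠ 0) (hec : qPoch (e / c) q k ≠ 0)
    (hce : qPoch ((q : ℂ) ^ (1 - (k : ℤ)) * (c / e)) q n ≠ 0) :
    phi43 ((q : ℂ) ^ (-(n : ℤ))) ((q : ℂ) ^ ((n : ℤ) - 1) * a * b * c * d) (c * f) (q * c / e)
        (c * d) ((q : ℂ) ^ k * a * b * c * f) ((q : ℂ) ^ (1 - (k : ℤ)) * (c / e)) q q =
      c ^ ((n : ℤ) - (k : ℤ)) *
        ((qPochInf q q * qPochInf (c * f) q * qPochInf ((q : ℂ) ^ n * a * c) q *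
            qPochInf ((q : ℂ) ^ n * b * c) q * qPochInf ((q : ℂ) ^ k * a * b) q *
            qPochInf ((q : ℂ) ^ k * a * f) q * qPochInf ((q : ℂ) ^ k * b * f) q) /
          (2 * (Real.pi : ℂ) * qPoch (c * d) q n * qPoch (e / c) q k *
            qPochInf ((q : ℂ) ^ k * a * b * c * f) q)) *
        awIntegral n k a b c d e f q := by
  have hq : ‖(q : ℂ)‖ < 1 := by simpa [abs_of_pos hq0] using hq1
  have hnn : ∀ s t : ℂ, ‖s‖ < 1 → ‖t‖ < 1 → ∀ m, qPochInf (s * t * (q : ℂ) ^ m) q ≠ 0 :=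
    fun s t hs ht m => qPochInf_ne_zero hq (norm_mul_pow_lt_one hq (norm_mul_lt_one hs ht.le) m)
  have nq := qPochInf_ne_zero hq hq
  have n1 : qPochInf (a * b * c * f * (q : ℂ) ^ k) q ≠ 0 := qPochInf_ne_zero hq <|
    norm_mul_pow_lt_one hq
      (norm_mul_lt_one (norm_mul_lt_one (norm_mul_lt_one ha1 hb1.le) hc1.le) hf1.le) k
  have n2 := hnn a b ha1 hb1 k
  have n3 := hnn a c ha1 hc1 n
  have n4 := hnn b c hb1 hc1 n
  have n5 := hnn a f ha1 hf1 k
  have n6 := hnn b f hb1 hf1 k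
  have n7 := qPochInf_ne_zero hq (norm_mul_lt_one hc1 hf1.le)
  have hpi : (Real.pi : ℂ) ≠ 0 := by exact_mod_cast Real.pi_ne_zero
  have p : ∀ (s t : ℂ) m, (q : ℂ) ^ m * s * t = s * t * (q : ℂ) ^ m := fun s t m => by ring
  have p' : (q : ℂ) ^ k * a * b * c * f = a * b * c * f * (q : ℂ) ^ k := by ring
  rw [awIntegral_eq_circInt n k hq d e ha1 hb1 hc1 hf1,
    circInt_awProdZ_eq_phi43 hq0 hq1 n k ha hb hc hd he hf ha1 hb1 hc1 hf1 hcd hce, p', p, p, p, p, p]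
  generalize phi43 _ _ _ _ _ _ _ _ _ = Φ
  rw [zpow_sub₀ hc, zpow_neg, zpow_natCast, zpow_natCast]
  have hcn := pow_ne_zero n hc
  have hck := pow_ne_zero k hc
  generalize c ^ n = Y1 at *
  generalize c ^ k = Y2 at *
  generalize qPochInf (a * b * c * f * (q : ℂ) ^ k) q = X1 at *
  generalize qPochInf (a * b * (q : ℂ) ^ k) q = X2 at *
  generalize qPochInf (a * c * (q : ℂ) ^ n) q = X3 at *
  generalize qPochInf (b * c * (q : ℂ) ^ n) q = X4 at *
  generalize qPochInf (a * f * (q : ℂ) ^ k) q = X5 at *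
  generalize qPochInf (b * f * (q : ℂ) ^ k) q = X6 at *
  generalize qPochInf (c * f) (q : ℂ) = X7 at *
  generalize qPoch (c * d) q n = X8 at *
  generalize qPoch (e / c) q k = X9 at *
  generalize qPochInf (q : ℂ) (q : ℂ) = X10 at *
  clear hce hnn p p'
  field_simp
  norm_num

end

theorem corollary7p2 (n k : ℕ) (q : ℝ) (hq0 : 0 < q) (hq1 : q < 1) (a b c d e f : ℂ)
    (ha : a ≠ 0) (hb : b ≠ 0) (hc : c ≠ 0) (hd : d ≠ 0) (he : e ≠ 0) (hf : f ≠ 0)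
    (ha1 : ‖a‖ < 1) (hb1 : ‖b‖ < 1) (hc1 : ‖c‖ < 1) (hf1 : ‖f‖ < 1) :
    IntervalIntegrable (awIntegrand n k a b c d e f q) MeasureTheory.volume (-1) 1 ∧
    (qPoch (c * d) q n ≠ 0 → qPoch (e / c) q k ≠ 0 →
      qPoch ((q : ℂ) ^ (1 - (k : ℤ)) * (c / e)) q n ≠ 0 →
      phi43 ((q : ℂ) ^ (-(n : ℤ))) ((q : ℂ) ^ ((n : ℤ) - 1) * a * b * c * d) (c * f) (q * c / e)
          (c * d) ((q : ℂ) ^ k * a * b * c * f) ((q : ℂ) ^ (1 - (k : ℤ)) * (c / e)) q q =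
        c ^ ((n : ℤ) - (k : ℤ)) *
          ((qPochInf q q * qPochInf (c * f) q * qPochInf ((q : ℂ) ^ n * a * c) q *
              qPochInf ((q : ℂ) ^ n * b * c) q * qPochInf ((q : ℂ) ^ k * a * b) q *
              qPochInf ((q : ℂ) ^ k * a * f) q * qPochInf ((q : ℂ) ^ k * b * f) q) /
            (2 * (Real.pi : ℂ) * qPoch (c * d) q n * qPoch (e / c) q k *
              qPochInf ((q : ℂ) ^ k * a * b * c * f) q)) *
          awIntegral n k a b c d e f q) ∧
    (qPoch (e * f) q k ≠ 0 → qPoch (d / f) q n ≠ 0 →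
      qPoch ((q : ℂ) ^ (1 - (n : ℤ)) * (f / d)) q k ≠ 0 →
      phi43 ((q : ℂ) ^ (-(k : ℤ))) ((q : ℂ) ^ ((k : ℤ) - 1) * a * b * e * f) (c * f) (q * f / d)
          (e * f) ((q : ℂ) ^ n * a * b * c * f) ((q : ℂ) ^ (1 - (n : ℤ)) * (f / d)) q q =
        f ^ ((k : ℤ) - (n : ℤ)) *
          ((qPochInf q q * qPochInf (c * f) q * qPochInf ((q : ℂ) ^ n * a * b) q *
              qPochInf ((q : ℂ) ^ n * a * c) q * qPochInf ((q : ℂ) ^ n * b * c) q *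
              qPochInf ((q : ℂ) ^ k * a * f) q * qPochInf ((q : ℂ) ^ k * b * f) q) /
            (2 * (Real.pi : ℂ) * qPoch (d / f) q n * qPoch (e * f) q k *
              qPochInf ((q : ℂ) ^ n * a * b * c * f) q)) *
          awIntegral n k a b c d e f q) := by
  have hq : ‖(q : ℂ)‖ < 1 := by simpa [abs_of_pos hq0] using hq1
  refine ⟨awIntegrand_intervalIntegrable n k hq d e ha1 hb1 hc1 hf1, fun h1 h2 h3 =>
    phi43_eq_awIntegral n k hq0 hq1 ha hb hc hd he hf ha1 hb1 hc1 hf1 h1 h2 h3, fun h1 h2 h3 => ?_⟩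
  -- Part (i) with `n ↔ k`, `c ↔ f`, `d ↔ e`; the two polynomials trade places and the weight is
  -- unchanged.
  have h := phi43_eq_awIntegral k n hq0 hq1 ha hb hf he hd hc ha1 hb1 hf1 hc1
    (by rwa [mul_comm f e]) h2 h3
  have p1 : (q : ℂ) ^ ((k : ℤ) - 1) * a * b * f * e = (q : ℂ) ^ ((k : ℤ) - 1) * a * b * e * f := by
    ring
  have p2 : (q : ℂ) ^ n * a * b * f * c = (q : ℂ) ^ n * a * b * c * f := by ring
  rw [p1, p2, mul_comm f c, mul_comm f e, ← awIntegral_symm] at h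
  rw [h]
  ring
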